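/- Let $D\ge 1$, $E:\mathbb R^D\to\mathbb R$, and let $p_*$ be a point with $E(p_*)=0$. Let $\mu$ be the phase measure $$d\mu=\frac{d\mathcal H^{D-1}}{|\nabla E|}\quad\text{on } \{E=0\},\qquad\text{with the convention } 1/0=+\infty .$$ Let $\mathcal C$ be the set of critical points of $E$ lying on $\{E=0\}$, and let $B(p_*,\eta)$ be the open ball of radius $\eta$. For integers $d=m+n\ge 0$, say that the *dichotomy in effective dimension $d$ with signature $(m,n)$* holds at $p_*$ if: * (finite) if $d>2$, some neighborhood $U$ of $p_*$ has $\mu(U)<\infty$; * (infinite) if $d\le 2$, every neighborhood $U$ of $p_*$ has $\mu(U)=\infty$, except when $d=2$ and $m=0$ or $n=0$; * (definite case) if $d\ge2$ and $m=0$ or $n=0$, some neighborhood $U$ of $p_*$ has $\mu(U)=0$; * (logarithmic divergence) if $d=2$ and $m=n=1$, then for all sufficiently small $\eta>0$ there are constants $0<c\le C<\infty$ such that, for all sufficiently small $\varepsilon>0$ (resp. $\gamma>0$), $$c\log\tfrac1\varepsilon\le\mu\big(\{x\in B(p_*,\eta):\operatorname{dist}(x,\mathcal C)>\varepsilon\}\big)\le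 C\log\tfrac1\varepsilon ,$$ $$c\log\tfrac1\gamma\le\int_{B(p_*,\eta)}\frac{\gamma}{\pi}\,\frac{dx}{E(x)^2+\gamma^2}\le C\log\tfrac1\gamma .$$ **(a) Non-degenerate critical points.** Suppose that, for some integer $k\ge1$, $E$ is $C^{k+2}$ in a neighborhood of $p_*$, that $\nabla E(p_*)=0$, and that the Hessian of $E$ at $p_*$ is invertible. Let $D_-$ and $D_+$ be the numbers of its negative and positive eigenvalues, counted with multiplicity. Then $D_-+D_+=D$, and there is a $C^k$ diffeomorphism $\varphi$ of a neighborhood $U$ of $p_*$ onto a neighborhood $V$ of $0=\varphi(p_*)$ such that $E(\varphi^{-1}(q))=-|q^-|^2+|q^+|^2$ on $V$, where $q=(q^-,q^+)$, $q^\pm\in\mathbb R^{D_\pm}$, and $0<c\le|\det D\varphi|\le C<\infty$ on $U$ for some constants $c,C$. Moreover the dichotomy in effective dimension $D$ with signature $(D_-,D_+)$ holds at $p_*$. **(b) $\delta$-degenerate critical points.** Suppose that there is a $C^1$ diffeomorphism $\varphi$ of a neighborhood $U$ of $p_*$ onto a neighborhood $V$ of $0=\varphi(p_*)$ such that $E(\varphi^{-1}(q))=-|q^-|^2+|q^+|^2$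 on $V$, where $q=(q^0,q^-,q^+)$ with $q^0\in\mathbb R^\delta$, $q^\pm\in\mathbb R^{D_\pm}$, $\delta+D_-+D_+=D$ (so the critical points of $E$ in $U$ form the $\delta$-dimensional submanifold $q^-=0$, $q^+=0$). Then the dichotomy in effective dimension $D'=D-\delta$ with signature $(D_-,D_+)$ holds at $p_*$. -/

import Mathlib

open Filter Topology MeasureTheory
open scoped ENNReal

namespace VanHove

noncomputable section

/-- The phase space `ℝ^D` with its Euclidean norm. -/
abbrev PhaseSpace (D : ℕ) : Type := EuclideanSpace ℝ (Fin D)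

/-- The phase measure `dμ = dH^{D-1} / |∇E|` carried by the resonant set `{E = 0}`.
The density takes values in `[0, ∞]`, with `1 / 0 = ∞` at points where `∇E = 0`. -/
def phaseMeasure {D : ℕ} (E : PhaseSpace D → ℝ) : Measure (PhaseSpace D) :=
  ((Measure.hausdorffMeasure ((D : ℝ) - 1)).restrict {x | E x = 0}).withDensity
    (fun x => ‖gradient E x‖ₑ⁻¹)

/-- The critical points of `E` on its zero set. -/
def criticalSet {D : ℕ} (E : PhaseSpace D → ℝ) : Set (PhaseSpace D) :=
  {x | E x = 0 ∧ DifferentiableAt ℝ E x ∧ gradient E x = 0}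

/-- The Hessian matrix `∂ᵢ∂ⱼE (p)`. -/
def hessian {D : ℕ} (E : PhaseSpace D → ℝ) (p : PhaseSpace D) : Matrix (Fin D) (Fin D) ℝ :=
  Matrix.of fun i j =>
    fderiv ℝ (fderiv ℝ E) p (EuclideanSpace.single i 1) (EuclideanSpace.single j 1)

/-- Number of negative eigenvalues, with multiplicity. -/
def numNegEigenvalues {D : ℕ} (A : Matrix (Fin D) (Fin D) ℝ) : ℕ :=
  A.charpoly.roots.countP (fun t => t < 0)

/-- Number of positive eigenvalues, with multiplicity. -/
def numPosEigenvalues {D : ℕ} (A : Matrix (Fin D) (Fin D) ℝ) : ℕ :=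
  A.charpoly.roots.countP (fun t => 0 < t)

/-- A sign pattern `σ` splits the coordinates `q = (q⁰, q⁻, q⁺)` into those with `σ i = 0`, `-1`
and `1`. `signCount σ s` is the number of coordinates of type `s`. -/
def signCount {D : ℕ} (σ : Fin D → SignType) (s : SignType) : ℕ :=
  (Finset.univ.filter (fun i => σ i = s)).card

/-- The normal form `-|q⁻|² + |q⁺|²`; it does not depend on `q⁰`. -/
def normalForm {D : ℕ} (σ : Fin D → SignType) (q : PhaseSpace D) : ℝ :=
  -(∑ i ∈ Finset.univ.filter (fun i => σ i = -1), q i ^ 2)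
    + ∑ i ∈ Finset.univ.filter (fun i => σ i = 1), q i ^ 2

/-- `φ` is a `C^k` diffeomorphism of an open neighborhood `φ.source` of `p` onto an open
neighborhood `φ.target` of `0 = φ p` in which `E` takes the form `E p - |q⁻|² + |q⁺|²`. -/
structure IsNormalFormChart {D : ℕ} (k : ℕ) (E : PhaseSpace D → ℝ) (p : PhaseSpace D)
    (σ : Fin D → SignType) (φ : OpenPartialHomeomorph (PhaseSpace D) (PhaseSpace D)) : Prop where
  mem_source : p ∈ φ.source
  map_zero : φ p = 0
  contDiffOn : ContDiffOn ℝ k φ φ.source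
  contDiffOn_symm : ContDiffOn ℝ k φ.symm φ.target
  eq_normalForm : ∀ q ∈ φ.target, E (φ.symm q) = E p + normalForm σ q

/-- `f ε` diverges exactly like `log (1 / ε)` as `ε → 0⁺`, up to constant factors;
in particular `f ε` is finite for small `ε > 0`. -/
def LogDivergent (f : ℝ → ℝ≥0∞) : Prop :=
  ∃ c C : ℝ, 0 < c ∧ 0 < C ∧ ∀ᶠ ε in 𝓝[>] (0 : ℝ),
    ENNReal.ofReal (c * Real.log (1 / ε)) ≤ f ε ∧ f ε ≤ ENNReal.ofReal (C * Real.log (1 / ε))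

/-- The Lorentzian approximate delta function of width `γ`. -/
def lorentzian (γ t : ℝ) : ℝ := γ / Real.pi * (1 / (t ^ 2 + γ ^ 2))

/-- The dichotomy for the phase measure near `p` in effective dimension `d = m + n`, where
`m` and `n` are the dimensions of the negative and the positive part of the normal form. -/
structure Dichotomy {D : ℕ} (E : PhaseSpace D → ℝ) (p : PhaseSpace D) (d m n : ℕ) : Prop where
  finite : 2 < d → ∃ U ∈ 𝓝 p, phaseMeasure E U < ∞
  infinite : d ≤ 2 → (d = 2 → m ≠ 0 ∧ n ≠ 0) → ∀ U ∈ 𝓝 p, phaseMeasure E U = ∞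
  /-- In the definite case the phase measure vanishes near `p`. -/
  definite : 2 ≤ d → m = 0 ∨ n = 0 → ∃ U ∈ 𝓝 p, phaseMeasure E U = 0
  /-- In effective dimension two the divergence is logarithmic in the distance at which the
  critical set is cut off. -/
  logarithmic : d = 2 → m ≠ 0 → n ≠ 0 → ∀ᶠ η in 𝓝[>] (0 : ℝ),
    LogDivergent fun ε =>
      phaseMeasure E {x ∈ Metric.ball p η | ε < Metric.infDist x (criticalSet E)}
  /-- In effective dimension two the divergence is logarithmic in the resonance width, when the
  delta function is broadened to a Lorentzian. -/
  broadened : d = 2 → m ≠ 0 → n ≠ 0 → ∀ᶠ η in 𝓝[>] (0 : ℝ),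
    LogDivergent fun γ => ∫⁻ x in Metric.ball p η, ENNReal.ofReal (lorentzian γ (E x))

end

end VanHove

namespace VanHove

open scoped NNReal

/-! ### Hausdorff measure under maps that are Lipschitz or antilipschitz on a set -/

section Hausdorff

variable {X Y : Type*} [MetricSpace X] [MeasurableSpace X] [BorelSpace X]
  [MetricSpace Y] [MeasurableSpace Y] [BorelSpace Y]

/-! In a normal form chart call a coordinate active if `σ i ≠ 0`. By the chain rule, `C^1` bounds on
`φ` and `φ.symm` near `p` make `|∇E|` comparable to the size of the active coordinates. Only this
and the bi-Lipschitz property are kept (`AdaptedChart`). Hausdorff measure changes by bounded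
factors under such maps, so every estimate reduces to one on the cone `quadForm σ = 0`, and
projecting out one coordinate turns it into a Lebesgue integral over a box; no area or coarea
formula is needed.

For `d > 2`, cut the cone into the pieces where one active coordinate dominates with a fixed sign.
Each piece is a Lipschitz graph over the other coordinates, two of which, `q_a` and `q_b`, are
active, and `1/|∇E|` is at most a constant times `|q_a|^(-1/2) |q_b|^(-1/2)`, which is integrable.
In the definite case with `d ≥ 2`, the zero set has codimension at least two and is null. For `d ≤
1`, a hyperplane piece of zeros of `E` is critical: the density is `∞` on a set of positive measure.

For signature `(1,1)`, light-cone coordinates give `E = uv`. The zero set is two hyperplanes; on `u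
= 0` the density is comparable to `1/|v|`, and distance to the critical set is comparable to `max
|u| |v|`, so a cutoff at `ε` gives `∫ dv/|v|` over `|v| ≳ ε`, a logarithm. The Lorentzian of `uv`
integrated over all `u` is exactly `1/|v|`, and `|v| < γ` contributes a bounded amount, so the same
logarithm appears in `γ`. Infinite measure for `d = 2` follows from the cutoff divergence.

Part (b) is this analysis (`IsNormalFormChart.dichotomy`). Part (a) adds the Morse lemma with a loss
of two derivatives. Hadamard's lemma applied twice writes `f x = ⟨S x x, x⟩` with `S` self-adjoint,
of class `C^k`, and `S 0 = J`, `J² = 1`. The inverse function theorem for `M ↦ M J M` at `J` gives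
`S = M J M` with `M` self-adjoint, so `Φ x = M x x` satisfies `f = ⟨J Φ, Φ⟩`. -/

theorem hausdorffMeasure_le_image_of_antilipschitzOn {g : X → Y} {K : ℝ≥0} {d : ℝ} (hd : 0 ≤ d)
    {S : Set X} (hg : ∀ x ∈ S, ∀ y ∈ S, dist x y ≤ K * dist (g x) (g y)) :
    μH[d] S ≤ (K : ℝ≥0∞) ^ d * μH[d] (g '' S) := by
  rcases S.eq_empty_or_nonempty with rfl | ⟨x₀, -⟩
  · simp
  have : Nonempty X := ⟨x₀⟩
  have hinj : Set.InjOn g S := fun x hx y hy h => by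
    have := hg x hx y hy
    rw [h, dist_self, mul_zero] at this
    exact dist_le_zero.1 this
  have hinv := hinj.leftInvOn_invFunOn
  have hlip : LipschitzOnWith K (Function.invFunOn g S) (g '' S) := by
    refine LipschitzOnWith.of_dist_le_mul ?_
    rintro _ ⟨x, hx, rfl⟩ _ ⟨y, hy, rfl⟩
    rw [hinv hx, hinv hy]
    exact hg x hx y hy
  have := hlip.hausdorffMeasure_image_le hd
  rwa [hinv.image_image] at this

/-- One-sided change of variables: the set inequality for Hausdorff measure says that the
push-forward of `μH[d]` on `S` is at most `K ^ d` times `μH[d]` on `T`, and integrals are monotone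
in the measure. -/
theorem setLIntegral_comp_le_of_antilipschitzOn {g : X → Y} {K : ℝ≥0} {d : ℝ} (hd : 0 ≤ d)
    {S : Set X} {T : Set Y} (hg : Measurable g)
    (hanti : ∀ x ∈ S, ∀ y ∈ S, dist x y ≤ K * dist (g x) (g y)) (hST : Set.MapsTo g S T)
    {f : Y → ℝ≥0∞} (hf : Measurable f) :
    ∫⁻ x in S, f (g x) ∂μH[d] ≤ (K : ℝ≥0∞) ^ d * ∫⁻ y in T, f y ∂μH[d] := by
  rw [← lintegral_map hf hg, ← smul_eq_mul, ← lintegral_smul_measure]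
  refine lintegral_mono' (Measure.le_iff.2 fun A hA => ?_) le_rfl
  rw [Measure.map_apply hg hA, Measure.restrict_apply (hg hA), Measure.smul_apply,
    Measure.restrict_apply hA, smul_eq_mul]
  refine (hausdorffMeasure_le_image_of_antilipschitzOn hd (g := g)
    fun x hx y hy => hanti x hx.2 y hy.2).trans ?_
  gcongr
  rintro _ ⟨x, hx, rfl⟩
  exact ⟨hx.1, hST hx.2⟩

theorem setLIntegral_le_comp_of_lipschitzOn {g : X → Y} {K : ℝ≥0} {d : ℝ} (hd : 0 ≤ d)
    {S : Set X} {T : Set Y} (hg : Measurable g)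
    (hlip : LipschitzOnWith K g S) (hST : T ⊆ g '' S)
    {f : Y → ℝ≥0∞} (hf : Measurable f) :
    ∫⁻ y in T, f y ∂μH[d] ≤ (K : ℝ≥0∞) ^ d * ∫⁻ x in S, f (g x) ∂μH[d] := by
  rw [← lintegral_map hf hg, ← smul_eq_mul, ← lintegral_smul_measure]
  refine lintegral_mono' (Measure.le_iff.2 fun A hA => ?_) le_rfl
  rw [Measure.smul_apply, Measure.map_apply hg hA, Measure.restrict_apply (hg hA),
    Measure.restrict_apply hA, smul_eq_mul]
  refine le_trans (measure_mono ?_)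
    ((hlip.mono (Set.inter_subset_right (s := g ⁻¹' A))).hausdorffMeasure_image_le hd)
  rintro y ⟨hyA, hyT⟩
  obtain ⟨x, hx, rfl⟩ := hST hyT
  exact ⟨x, ⟨hyA, hx⟩, rfl⟩

end Hausdorff

/-- For the sup metric the normalisations agree exactly, which is why chart coordinates live in `Fin
n → ℝ` and not in Euclidean space. -/
theorem hausdorffMeasure_fin (n : ℕ) : (μH[(n : ℝ)] : Measure (Fin n → ℝ)) = volume := by
  simpa using hausdorffMeasure_pi_real (ι := Fin n)

/-! ### Integrals over boxes -/

theorem lintegral_fin_prod {n : ℕ} (f : Fin n → ℝ → ℝ≥0∞) (hf : ∀ i, Measurable (f i)) :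
    ∫⁻ x : Fin n → ℝ, ∏ i, f i (x i) = ∏ i, ∫⁻ t, f i t := by
  induction n with
  | zero => simp [volume_pi]
  | succ n ih =>
    have h := (volume_preserving_piFinSuccAbove (fun _ : Fin (n + 1) => ℝ) 0).symm
    rw [← h.lintegral_comp (by fun_prop)]
    simp only [Fin.prod_univ_succ, ← ih (fun i => f i.succ) fun i => hf _]
    have : Measurable fun y : Fin n → ℝ => ∏ i, f i.succ (y i) := by
      have := fun i : Fin n => hf i.succ
      fun_prop
    rw [← lintegral_prod_mul (hf 0).aemeasurable this.aemeasurable]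
    rfl

theorem measurableSet_box {n : ℕ} (R : ℝ) :
    MeasurableSet {q : Fin n → ℝ | ∀ k, q k ∈ Set.Icc (-R) R} := by
  have := MeasurableSet.univ_pi (t := fun _ : Fin n => Set.Icc (-R) R) fun _ => measurableSet_Icc
  convert this using 1
  ext q; simp only [Set.mem_ofPred_eq, Set.mem_univ_pi]

theorem lintegral_Icc_inv {a b : ℝ} (ha : 0 < a) (hab : a ≤ b) :
    ∫⁻ t in Set.Icc a b, ENNReal.ofReal t⁻¹ = ENNReal.ofReal (Real.log (b / a)) := by
  have hb : 0 < b := ha.trans_le hab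
  have hint : IntervalIntegrable (fun t : ℝ => t⁻¹) volume a b :=
    intervalIntegral.intervalIntegrable_inv (fun t ht => by
      rw [Set.uIcc_of_le hab] at ht
      exact (ha.trans_le ht.1).ne') continuousOn_id
  rw [← integral_inv_of_pos ha hb, intervalIntegral.integral_of_le hab,
    ← integral_Icc_eq_integral_Ioc, ofReal_integral_eq_lintegral_ofReal]
  · exact (intervalIntegrable_iff_integrableOn_Icc_of_le hab (by simp)).1 hint
  · refine (ae_restrict_mem measurableSet_Icc).mono fun t ht => ?_
    exact inv_nonneg.2 (ha.le.trans ht.1)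

theorem lintegral_abs_eq (f : ℝ → ℝ≥0∞) (hf : Measurable f) :
    ∫⁻ t, f |t| = 2 * ∫⁻ t in Set.Ioi 0, f t := by
  have h1 : ∫⁻ t in Set.Ioi 0, f |t| = ∫⁻ t in Set.Ioi 0, f t :=
    setLIntegral_congr_fun measurableSet_Ioi fun t ht => by simp [abs_of_pos (Set.mem_Ioi.1 ht)]
  have h2 : ∫⁻ t in Set.Iio 0, f |t| = ∫⁻ t in Set.Ioi 0, f t := by
    rw [← h1]
    have := (Measure.measurePreserving_neg (volume : Measure ℝ)).setLIntegral_comp_preimage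
      (measurableSet_Ioi (a := (0 : ℝ))) (f := fun t => f |t|) (by fun_prop)
    simpa using this
  have h3 : Set.Iic (0 : ℝ) =ᵐ[volume] Set.Iio 0 := Iio_ae_eq_Iic.symm
  rw [← lintegral_add_compl _ (measurableSet_Ioi (a := (0 : ℝ))), Set.compl_Ioi, h1,
    setLIntegral_congr h3, h2, two_mul]

theorem lintegral_abs_rpow_lt_top (R : ℝ) :
    ∫⁻ t in Set.Icc (-R) R, ENNReal.ofReal (|t| ^ (-(1 / 2) : ℝ)) < ∞ := by
  rcases lt_or_ge R 0 with hR | hR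
  · rw [Set.Icc_eq_empty (by linarith)]; simp
  rw [← lintegral_indicator measurableSet_Icc]
  have : (fun t : ℝ => (Set.Icc (-R) R).indicator
      (fun t => ENNReal.ofReal (|t| ^ (-(1 / 2) : ℝ))) t) =
      fun t => (Set.Icc (-R) R).indicator (fun t => ENNReal.ofReal (t ^ (-(1 / 2) : ℝ))) |t| := by
    ext t
    by_cases h : |t| ≤ R
    · rw [Set.indicator_of_mem (Set.mem_Icc.2 (abs_le.1 h)), Set.indicator_of_mem]
      exact ⟨by linarith [abs_nonneg t], h⟩
    · rw [Set.indicator_of_notMem fun h' : t ∈ Set.Icc _ _ => h (abs_le.2 h'), Set.indicator_of_notMem]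
      exact fun h' => h h'.2
  rw [this, lintegral_abs_eq _ (Measurable.indicator (by fun_prop) measurableSet_Icc),
    setLIntegral_indicator measurableSet_Icc]
  refine ENNReal.mul_lt_top (by simp) ?_
  have hint : IntegrableOn (fun t : ℝ => t ^ (-(1 / 2) : ℝ)) (Set.Ioc 0 R) :=
    (intervalIntegrable_iff_integrableOn_Ioc_of_le hR).1
      (intervalIntegral.intervalIntegrable_rpow' (by norm_num))
  refine lt_of_le_of_lt (lintegral_mono_set ?_) hint.lintegral_lt_top
  exact fun t ht => ⟨ht.2, ht.1.2⟩

theorem lintegral_abs_inv_le {a b : ℝ} (ha : 0 < a) (hab : a ≤ b) :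
    ∫⁻ t in {t : ℝ | a ≤ |t| ∧ |t| ≤ b}, ENNReal.ofReal |t|⁻¹ ≤
      ENNReal.ofReal (2 * Real.log (b / a)) := by
  have hm : MeasurableSet {t : ℝ | a ≤ |t| ∧ |t| ≤ b} :=
    measurableSet_Icc.preimage (f := fun t : ℝ => |t|) (by fun_prop)
  rw [← lintegral_indicator hm]
  have : (fun t : ℝ => {t : ℝ | a ≤ |t| ∧ |t| ≤ b}.indicator
      (fun t => ENNReal.ofReal |t|⁻¹) t) =
      fun t => (Set.Icc a b).indicator (fun t => ENNReal.ofReal t⁻¹) |t| := by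
    ext t
    simp [Set.indicator_apply]
  rw [this, lintegral_abs_eq _ (Measurable.indicator (by fun_prop) measurableSet_Icc),
    setLIntegral_indicator measurableSet_Icc, ENNReal.ofReal_mul (by norm_num),
    ← lintegral_Icc_inv ha hab]
  simp only [ENNReal.ofReal_ofNat]
  gcongr
  exact Set.inter_subset_left

/-! ### The Lorentzian in one variable. -/

theorem measurable_lorentzian (γ : ℝ) : Measurable (lorentzian γ) := by
  unfold lorentzian; fun_prop

/-- The substitution `u ↦ u v / γ` reduces this to `∫ 1 / (1 + u²) = π`; the width `γ` drops out. -/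
theorem lintegral_lorentzian_mul {γ v : ℝ} (hγ : 0 < γ) (hv : v ≠ 0) :
    ∫⁻ u, ENNReal.ofReal (lorentzian γ (u * v)) = ENNReal.ofReal |v|⁻¹ := by
  have heq : (fun u => lorentzian γ (u * v)) =
      fun u => (Real.pi * γ)⁻¹ * (1 + (u * (v / γ)) ^ 2)⁻¹ := by
    ext u
    unfold lorentzian
    have h1 : (u * v) ^ 2 + γ ^ 2 ≠ 0 := by positivity
    have h2 : 1 + (u * (v / γ)) ^ 2 ≠ 0 := by positivity
    have hpi := Real.pi_ne_zero
    field_simp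
    ring
  have hne : v / γ ≠ 0 := div_ne_zero hv hγ.ne'
  have hint : Integrable fun u : ℝ => (Real.pi * γ)⁻¹ * (1 + (u * (v / γ)) ^ 2)⁻¹ :=
    ((integrable_inv_one_add_sq).comp_mul_right' hne).const_mul _
  simp only [funext_iff] at heq
  simp only [heq]
  rw [← ofReal_integral_eq_lintegral_ofReal hint (ae_of_all _ fun u => by positivity),
    integral_const_mul, Measure.integral_comp_mul_right (fun u : ℝ => (1 + u ^ 2)⁻¹),
    integral_univ_inv_one_add_sq, inv_div, abs_div, abs_of_pos hγ]
  congr 1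
  have hpi := Real.pi_ne_zero
  have := abs_ne_zero.2 hv
  simp only [smul_eq_mul]
  field_simp

theorem lorentzian_le {γ : ℝ} (hγ : 0 < γ) (t : ℝ) : lorentzian γ t ≤ γ⁻¹ := by
  unfold lorentzian
  have h1 : 1 / (t ^ 2 + γ ^ 2) ≤ 1 / γ ^ 2 :=
    one_div_le_one_div_of_le (by positivity) (by nlinarith [sq_nonneg t])
  have h2 : γ / Real.pi ≤ γ := div_le_self hγ.le (by linarith [Real.pi_gt_three])
  calc γ / Real.pi * (1 / (t ^ 2 + γ ^ 2)) ≤ γ * (1 / γ ^ 2) := by gcongr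
    _ = γ⁻¹ := by field_simp

theorem le_lorentzian {γ t : ℝ} (hγ : 0 < γ) (ht : |t| ≤ γ) :
    (2 * Real.pi * γ)⁻¹ ≤ lorentzian γ t := by
  unfold lorentzian
  have h1 : 1 / (γ ^ 2 + γ ^ 2) ≤ 1 / (t ^ 2 + γ ^ 2) :=
    one_div_le_one_div_of_le (by positivity) (by nlinarith [sq_abs t, abs_nonneg t])
  calc (2 * Real.pi * γ)⁻¹ = γ / Real.pi * (1 / (γ ^ 2 + γ ^ 2)) := by
        have hpi := Real.pi_ne_zero
        field_simp; ring
    _ ≤ _ := by gcongr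

/-! ### Adapted bi-Lipschitz charts -/

/-- The normal form as a function on `Fin D → ℝ`. -/
def quadForm {D : ℕ} (σ : Fin D → SignType) (q : Fin D → ℝ) : ℝ := ∑ i, (σ i : ℝ) * q i ^ 2

theorem normalForm_eq_quadForm {D : ℕ} (σ : Fin D → SignType) (q : PhaseSpace D) :
    normalForm σ q = quadForm σ q.ofLp := by
  unfold normalForm quadForm
  rw [Finset.sum_filter, Finset.sum_filter, ← Finset.sum_neg_distrib, ← Finset.sum_add_distrib]
  refine Finset.sum_congr rfl fun i _ => ?_
  rcases h : σ i <;> simp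

/-- `ψ` is a globally Lipschitz map that is a bi-Lipschitz chart on the ball of radius `r` around
`p`, in which `E` takes the form `N` and the size of `∇E` is the size of the coordinates in `A`. -/
structure AdaptedChart {D : ℕ} (E : PhaseSpace D → ℝ) (p : PhaseSpace D) (A : Finset (Fin D))
    (N : (Fin D → ℝ) → ℝ) (ψ : PhaseSpace D → Fin D → ℝ) (r : ℝ) (L : ℝ≥0) : Prop where
  r_pos : 0 < r
  L_pos : 0 < L
  lip : LipschitzWith L ψ
  antilip : ∀ x ∈ Metric.ball p r, ∀ y ∈ Metric.ball p r, dist x y ≤ L * dist (ψ x) (ψ y)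
  map_base : ψ p = 0
  surj : ∀ ρ > 0, ∃ s > 0, ∀ q : Fin D → ℝ, ‖q‖ < s → ∃ x ∈ Metric.ball p ρ, ψ x = q
  diff : ∀ x ∈ Metric.ball p r, DifferentiableAt ℝ E x
  eq : ∀ x ∈ Metric.ball p r, E x = N (ψ x)
  grad_le : ∀ x ∈ Metric.ball p r, ∀ M : ℝ, 0 ≤ M → (∀ i ∈ A, |ψ x i| ≤ M) →
    ‖gradient E x‖ ≤ L * M
  le_grad : ∀ x ∈ Metric.ball p r, ∀ i ∈ A, |ψ x i| ≤ L * ‖gradient E x‖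

theorem norm_gradient {D : ℕ} (E : PhaseSpace D → ℝ) (x : PhaseSpace D) :
    ‖gradient E x‖ = ‖fderiv ℝ E x‖ := by
  unfold gradient; exact LinearIsometryEquiv.norm_map _ _

theorem hasFDerivAt_normalForm {D : ℕ} (σ : Fin D → SignType) (q : PhaseSpace D) :
    HasFDerivAt (normalForm σ)
      (∑ i, ((σ i : ℝ) * (2 * q i)) • (EuclideanSpace.proj i : PhaseSpace D →L[ℝ] ℝ)) q := by
  have h : normalForm σ = fun q : PhaseSpace D => ∑ i, (σ i : ℝ) * (q i) ^ 2 :=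
    funext fun q => normalForm_eq_quadForm σ q
  rw [h]
  refine HasFDerivAt.fun_sum fun i _ => ?_
  have h1 : HasFDerivAt (fun q : PhaseSpace D => q i)
      (EuclideanSpace.proj i : PhaseSpace D →L[ℝ] ℝ) q :=
    (EuclideanSpace.proj i : PhaseSpace D →L[ℝ] ℝ).hasFDerivAt
  have h2 := (h1.pow 2).const_mul (σ i : ℝ)
  refine h2.congr_fderiv ?_
  ext v
  simp [mul_assoc]

theorem norm_fderiv_normalForm_le {D : ℕ} (σ : Fin D → SignType) (q : PhaseSpace D) {M : ℝ}
    (hM : 0 ≤ M) (h : ∀ i, σ i ≠ 0 → |q i| ≤ M) : ‖fderiv ℝ (normalForm σ) q‖ ≤ 2 * D * M := by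
  rw [(hasFDerivAt_normalForm σ q).fderiv]
  have hterm : ∀ i ∈ (Finset.univ : Finset (Fin D)), ‖((σ i : ℝ) * (2 * q i)) •
      (EuclideanSpace.proj i : PhaseSpace D →L[ℝ] ℝ)‖ ≤ 2 * M := by
    intro i _
    rw [norm_smul]
    have hp : ‖(EuclideanSpace.proj i : PhaseSpace D →L[ℝ] ℝ)‖ ≤ 1 :=
      ContinuousLinearMap.opNorm_le_bound _ zero_le_one fun x => by
        simpa using PiLp.norm_apply_le x i
    have hc : ‖(σ i : ℝ) * (2 * q i)‖ ≤ 2 * M := by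
      rcases hσ : σ i
      · simp [hM]
      · have := h i (by simp [hσ])
        simpa [abs_mul] using this
      · have := h i (by simp [hσ])
        simpa [abs_mul] using this
    calc _ ≤ 2 * M * 1 := mul_le_mul hc hp (norm_nonneg _) (by positivity)
      _ = _ := mul_one _
  refine (norm_sum_le _ _).trans ((Finset.sum_le_sum hterm).trans (le_of_eq ?_))
  simp; ring

theorem abs_le_norm_fderiv_normalForm {D : ℕ} (σ : Fin D → SignType) (q : PhaseSpace D)
    {i : Fin D} (hi : σ i ≠ 0) : |q i| ≤ ‖fderiv ℝ (normalForm σ) q‖ := by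
  have h := (fderiv ℝ (normalForm σ) q).le_opNorm (EuclideanSpace.single i 1)
  rw [PiLp.norm_single, norm_one, mul_one] at h
  refine le_trans ?_ h
  rw [(hasFDerivAt_normalForm σ q).fderiv]
  have : (∑ j, ((σ j : ℝ) * (2 * q j)) • (EuclideanSpace.proj j : PhaseSpace D →L[ℝ] ℝ))
      (EuclideanSpace.single i 1) = (σ i : ℝ) * (2 * q i) := by
    simp
  rw [this, Real.norm_eq_abs, abs_mul, abs_mul]
  have hs : |(σ i : ℝ)| = 1 := by
    rcases hσ : σ i <;> simp_all
  rw [hs]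
  norm_num
  linarith [abs_nonneg (q i)]

/-- Lipschitz bounds for `φ` and `φ.symm` near `p` also bound their derivatives, so the chain rule
in both directions compares `∇E` with the gradient of the normal form, which is twice the vector of
active coordinates up to signs. -/
theorem IsNormalFormChart.exists_adaptedChart {D : ℕ} {E : PhaseSpace D → ℝ} {p : PhaseSpace D}
    (hp : E p = 0) {σ : Fin D → SignType}
    {φ : OpenPartialHomeomorph (PhaseSpace D) (PhaseSpace D)}
    (hφ : IsNormalFormChart 1 E p σ φ) :
    ∃ ψ r L, AdaptedChart E p (Finset.univ.filter fun i => σ i ≠ 0) (quadForm σ) ψ r L := by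
  have hzero : (0 : PhaseSpace D) ∈ φ.target := hφ.map_zero ▸ φ.map_source hφ.mem_source
  have hsymm0 : φ.symm 0 = p := by rw [← hφ.map_zero, φ.left_inv hφ.mem_source]
  have hone : ((1 : ℕ) : WithTop ℕ∞) = 1 := by norm_num
  have hc1 : ∀ x ∈ φ.source, ContDiffAt ℝ 1 φ x := fun x hx =>
    hone ▸ hφ.contDiffOn.contDiffAt (φ.open_source.mem_nhds hx)
  have hc2 : ∀ x ∈ φ.target, ContDiffAt ℝ 1 φ.symm x := fun x hx =>
    hone ▸ hφ.contDiffOn_symm.contDiffAt (φ.open_target.mem_nhds hx)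
  obtain ⟨K₁, t₁, ht₁, hK₁⟩ := (hc1 p hφ.mem_source).exists_lipschitzOnWith
  obtain ⟨K₂, t₂, ht₂, hK₂⟩ := (hc2 0 hzero).exists_lipschitzOnWith
  have hV : φ.source ∩ interior t₁ ∩ (φ.source ∩ φ ⁻¹' interior t₂) ∈ 𝓝 p := by
    refine inter_mem (inter_mem (φ.open_source.mem_nhds hφ.mem_source)
      (interior_mem_nhds.2 ht₁)) ((φ.isOpen_inter_preimage isOpen_interior).mem_nhds
        ⟨hφ.mem_source, ?_⟩)
    rw [Set.mem_preimage, hφ.map_zero]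
    exact mem_interior_iff_mem_nhds.2 ht₂
  obtain ⟨r, hr, hball⟩ := Metric.mem_nhds_iff.1 hV
  set a : ℝ≥0 := (Fintype.card (Fin D) : ℝ≥0) ^ (1 / (2 : ℝ≥0∞)).toReal with ha
  have hanti : AntilipschitzWith a (WithLp.ofLp : PhaseSpace D → Fin D → ℝ) :=
    PiLp.antilipschitzWith_ofLp 2 _
  have hlip : LipschitzWith 1 (WithLp.ofLp : PhaseSpace D → Fin D → ℝ) :=
    PiLp.lipschitzWith_ofLp 2 _
  have hψ₀ : LipschitzOnWith K₁ (fun x => (φ x).ofLp) (Metric.ball p r) := by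
    have := hlip.comp_lipschitzOnWith
      (hK₁.mono fun x hx => interior_subset (hball hx).1.2)
    rw [one_mul] at this
    exact this
  -- Extending coordinate by coordinate keeps the constant and yields a chart map that is
  -- continuous, hence measurable, on the whole space.
  obtain ⟨ψ, hψ, hEq⟩ := hψ₀.extend_pi
  have hEq' : ∀ x ∈ Metric.ball p r, ψ x = (φ x).ofLp := fun x hx => (hEq hx).symm
  have hEN : ∀ x ∈ φ.source, E x = normalForm σ (φ x) := fun x hx => by
    have := hφ.eq_normalForm (φ x) (φ.map_source hx)
    rwa [φ.left_inv hx, hp, zero_add] at this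
  have hder : ∀ x ∈ Metric.ball p r, DifferentiableAt ℝ E x ∧
      ‖fderiv ℝ E x‖ ≤ ‖fderiv ℝ (normalForm σ) (φ x)‖ * K₁ ∧
      ‖fderiv ℝ (normalForm σ) (φ x)‖ ≤ ‖fderiv ℝ E x‖ * K₂ := by
    intro x hx
    obtain ⟨⟨hs, h1⟩, -, h2⟩ := hball hx
    have hd1 := (hc1 x hs).differentiableAt one_ne_zero
    have hd2 := (hc2 _ (φ.map_source hs)).differentiableAt one_ne_zero
    have hN := (hasFDerivAt_normalForm σ (φ x)).differentiableAt
    have e1 : E =ᶠ[𝓝 x] normalForm σ ∘ φ := by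
      filter_upwards [φ.open_source.mem_nhds hs] with y hy using hEN y hy
    have hdE : DifferentiableAt ℝ E x := (hN.comp x hd1).congr_of_eventuallyEq e1
    have e2 : normalForm σ =ᶠ[𝓝 (φ x)] E ∘ φ.symm := by
      filter_upwards [φ.open_target.mem_nhds (φ.map_source hs)] with y hy
      rw [Function.comp_apply, hφ.eq_normalForm y hy, hp, zero_add]
    refine ⟨hdE, ?_, ?_⟩
    · rw [e1.fderiv_eq, fderiv_comp x hN hd1]
      refine (ContinuousLinearMap.opNorm_comp_le _ _).trans ?_
      gcongr
      exact norm_fderiv_le_of_lipschitzOn ℝ (mem_interior_iff_mem_nhds.1 h1) hK₁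
    · have hdE' : DifferentiableAt ℝ E (φ.symm (φ x)) := by rwa [φ.left_inv hs]
      rw [e2.fderiv_eq, fderiv_comp _ hdE' hd2, φ.left_inv hs]
      refine (ContinuousLinearMap.opNorm_comp_le _ _).trans ?_
      gcongr
      exact norm_fderiv_le_of_lipschitzOn ℝ (mem_interior_iff_mem_nhds.1 h2) hK₂
  -- The summands serve in turn for positivity, the Lipschitz bound, the antilipschitz bound (`a`
  -- compares Euclidean and sup norms), and the upper and lower gradient bounds.
  set L : ℝ≥0 := 1 + K₁ + K₂ * a + 2 * D * K₁ + K₂ with hL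
  have hL1 : K₁ ≤ L := by
    rw [hL, add_assoc, add_assoc, add_comm 1, add_assoc]; exact le_self_add
  refine ⟨ψ, r, L, hr, by positivity, hψ.weaken hL1, ?_, ?_, ?_, fun x hx => (hder x hx).1, ?_,
    ?_, ?_⟩
  · intro x hx y hy
    obtain ⟨⟨hsx, -⟩, -, h2x⟩ := hball hx
    obtain ⟨⟨hsy, -⟩, -, h2y⟩ := hball hy
    have := hK₂.dist_le_mul (φ x) (interior_subset h2x) (φ y) (interior_subset h2y)
    rw [φ.left_inv hsx, φ.left_inv hsy] at this
    rw [hEq' x hx, hEq' y hy]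
    have h3 := hanti.le_mul_dist (φ x) (φ y)
    calc dist x y ≤ K₂ * (a * dist (φ x).ofLp (φ y).ofLp) := this.trans (by gcongr)
      _ = (K₂ * a : ℝ≥0) * dist (φ x).ofLp (φ y).ofLp := by push_cast; ring
      _ ≤ L * dist (φ x).ofLp (φ y).ofLp := by
        gcongr
        rw [hL, add_comm (1 + K₁), add_assoc, add_assoc]
        exact le_self_add
  · rw [hEq' p (Metric.mem_ball_self hr), hφ.map_zero]; rfl
  · intro ρ hρ
    have hcont : ContinuousAt (fun q : Fin D → ℝ => φ.symm (WithLp.toLp 2 q)) 0 :=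
      ContinuousAt.comp (g := φ.symm) (φ.symm.continuousAt hzero)
        (PiLp.continuous_toLp 2 _).continuousAt
    have h1 : ∀ᶠ q : Fin D → ℝ in 𝓝 0, WithLp.toLp 2 q ∈ φ.target :=
      (PiLp.continuous_toLp 2 _).continuousAt.eventually (φ.open_target.mem_nhds hzero)
    have h2 : ∀ᶠ q : Fin D → ℝ in 𝓝 0,
        φ.symm (WithLp.toLp 2 q) ∈ Metric.ball p (min ρ r) := by
      refine hcont.eventually (Metric.isOpen_ball.mem_nhds ?_)
      change φ.symm 0 ∈ _
      rw [hsymm0]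
      exact Metric.mem_ball_self (lt_min hρ hr)
    obtain ⟨s, hs, hss⟩ := Metric.eventually_nhds_iff.1 (h1.and h2)
    refine ⟨s, hs, fun q hq => ⟨φ.symm (WithLp.toLp 2 q), ?_, ?_⟩⟩
    · exact Metric.ball_subset_ball (min_le_left _ _) (hss (by simpa using hq)).2
    · have h3 := hss (y := q) (by simpa using hq)
      rw [hEq' _ (Metric.ball_subset_ball (min_le_right _ _) h3.2), φ.right_inv h3.1]
  · intro x hx
    rw [hEN x (hball hx).1.1, normalForm_eq_quadForm, hEq' x hx]
  · intro x hx M hM h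
    rw [norm_gradient]
    have h1 := norm_fderiv_normalForm_le σ (φ x) hM fun i hi => by
      have := h i (by simpa using hi)
      rwa [hEq' x hx] at this
    calc ‖fderiv ℝ E x‖ ≤ 2 * D * M * K₁ := (hder x hx).2.1.trans (by gcongr)
      _ = (2 * D * K₁ : ℝ≥0) * M := by push_cast; ring
      _ ≤ L * M := by
        gcongr
        rw [hL, add_right_comm, add_comm _ (2 * (D : ℝ≥0) * K₁)]
        exact le_self_add
  · intro x hx i hi
    rw [norm_gradient, hEq' x hx]
    have h1 := abs_le_norm_fderiv_normalForm σ (φ x) (by simpa using hi : σ i ≠ 0)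
    refine h1.trans ((hder x hx).2.2.trans ?_)
    rw [mul_comm]
    gcongr
    rw [hL]
    exact le_add_self

/-! ### Projections along a coordinate and null sets -/

/-- Forget the `i`-th coordinate. -/
def dropCoord {n : ℕ} (i : Fin (n + 1)) (q : Fin (n + 1) → ℝ) : Fin n → ℝ :=
  fun j => q (i.succAbove j)

theorem lipschitzWith_dropCoord {n : ℕ} (i : Fin (n + 1)) : LipschitzWith 1 (dropCoord i) :=
  LipschitzWith.of_dist_le_mul fun x y => by
    rw [NNReal.coe_one, one_mul]
    exact (dist_pi_le_iff dist_nonneg).2 fun j => dist_le_pi_dist x y _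

theorem dist_le_of_dropCoord {n : ℕ} {i : Fin (n + 1)} {q q' : Fin (n + 1) → ℝ} {c : ℝ}
    (hc : 1 ≤ c) (h : |q i - q' i| ≤ c * dist (dropCoord i q) (dropCoord i q')) :
    dist q q' ≤ c * dist (dropCoord i q) (dropCoord i q') := by
  have h0 : 0 ≤ dist (dropCoord i q) (dropCoord i q') := dist_nonneg
  refine (dist_pi_le_iff (by positivity)).2 fun k => ?_
  rcases eq_or_ne k i with rfl | hk
  · exact h
  · obtain ⟨j, rfl⟩ := Fin.exists_succAbove_eq hk
    exact (dist_le_pi_dist (dropCoord i q) (dropCoord i q') j).trans (le_mul_of_one_le_left h0 hc)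

theorem phaseMeasure_apply {n : ℕ} (E : PhaseSpace (n + 1) → ℝ) {S : Set (PhaseSpace (n + 1))}
    (hS : MeasurableSet S) :
    phaseMeasure E S = ∫⁻ x in S ∩ {x | E x = 0}, ‖gradient E x‖ₑ⁻¹ ∂μH[(n : ℝ)] := by
  have hn : ((n + 1 : ℕ) : ℝ) - 1 = n := by push_cast; ring
  unfold phaseMeasure
  rw [withDensity_apply _ hS, Measure.restrict_restrict hS, hn]

namespace AdaptedChart

variable {n : ℕ} {E : PhaseSpace (n + 1) → ℝ} {p : PhaseSpace (n + 1)}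
  {A : Finset (Fin (n + 1))} {N : (Fin (n + 1) → ℝ) → ℝ} {ψ : PhaseSpace (n + 1) → Fin (n + 1) → ℝ}
  {r : ℝ} {L : ℝ≥0}

theorem measurable (h : AdaptedChart E p A N ψ r L) : Measurable ψ := h.lip.continuous.measurable

theorem abs_apply_le (h : AdaptedChart E p A N ψ r L) (x : PhaseSpace (n + 1)) (k : Fin (n + 1)) :
    |ψ x k| ≤ L * dist x p := by
  have h1 := h.lip.dist_le_mul x p
  rw [h.map_base, dist_zero_right] at h1
  exact (norm_le_pi_norm (ψ x) k).trans h1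

/-- A set that is a Lipschitz graph in the `i`-th coordinate can be projected along that coordinate
without losing more than a constant factor in Hausdorff measure. -/
theorem dist_le_dropCoord (h : AdaptedChart E p A N ψ r L) {i : Fin (n + 1)} {c : ℝ≥0}
    (hc : 1 ≤ c) {S : Set (PhaseSpace (n + 1))} (hS : S ⊆ Metric.ball p r)
    (hi : ∀ x ∈ S, ∀ y ∈ S,
      |ψ x i - ψ y i| ≤ c * dist (dropCoord i (ψ x)) (dropCoord i (ψ y))) :
    ∀ x ∈ S, ∀ y ∈ S,
      dist x y ≤ (L * c : ℝ≥0) * dist (dropCoord i (ψ x)) (dropCoord i (ψ y)) := by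
  intro x hx y hy
  refine (h.antilip x (hS hx) y (hS hy)).trans ?_
  rw [NNReal.coe_mul, mul_assoc]
  gcongr
  exact dist_le_of_dropCoord (by exact_mod_cast hc) (hi x hx y hy)

theorem measurable_dropCoord_comp (h : AdaptedChart E p A N ψ r L) (i : Fin (n + 1)) :
    Measurable fun x => dropCoord i (ψ x) :=
  (lipschitzWith_dropCoord i).continuous.measurable.comp h.measurable

theorem lipschitzOn_dropCoord_comp (h : AdaptedChart E p A N ψ r L) (i : Fin (n + 1))
    (S : Set (PhaseSpace (n + 1))) : LipschitzOnWith L (fun x => dropCoord i (ψ x)) S := by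
  have := ((lipschitzWith_dropCoord i).comp h.lip).lipschitzOnWith (s := S)
  rwa [one_mul] at this

/-- On `q i = 0` forgetting `q i` is antilipschitz, and the image lies in the Lebesgue-null
hyperplane `q j = 0` of `ℝⁿ`. -/
theorem hausdorffMeasure_codim_two (h : AdaptedChart E p A N ψ r L) {i j : Fin (n + 1)}
    (hij : j ≠ i) : μH[(n : ℝ)] {x ∈ Metric.ball p r | ψ x i = 0 ∧ ψ x j = 0} = 0 := by
  obtain ⟨j', rfl⟩ := Fin.exists_succAbove_eq hij
  have hanti := h.dist_le_dropCoord (i := i) (c := 1) le_rfl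
    (S := {x ∈ Metric.ball p r | ψ x i = 0 ∧ ψ x (i.succAbove j') = 0}) (fun x hx => hx.1)
    (fun x hx y hy => by rw [hx.2.1, hy.2.1]; simp)
  refine le_antisymm ((hausdorffMeasure_le_image_of_antilipschitzOn n.cast_nonneg hanti).trans ?_)
    zero_le
  have h0 : μH[(n : ℝ)] ((fun x => dropCoord i (ψ x)) ''
      {x ∈ Metric.ball p r | ψ x i = 0 ∧ ψ x (i.succAbove j') = 0}) = 0 := by
    rw [hausdorffMeasure_fin]
    refine measure_mono_null ?_ (Measure.pi_hyperplane (fun _ : Fin n => (volume : Measure ℝ)) j' 0)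
    rintro _ ⟨x, hx, rfl⟩
    exact hx.2.2
  rw [h0, mul_zero]

theorem phaseMeasure_ball_eq_zero (h : AdaptedChart E p A N ψ r L) {i j : Fin (n + 1)}
    (hij : j ≠ i) (hN : ∀ q, N q = 0 → q i = 0 ∧ q j = 0) :
    phaseMeasure E (Metric.ball p r) = 0 := by
  rw [phaseMeasure_apply E Metric.isOpen_ball.measurableSet]
  refine setLIntegral_measure_zero _ _ (measure_mono_null ?_ (h.hausdorffMeasure_codim_two hij))
  rintro x ⟨hx, hx0⟩
  exact ⟨hx, hN _ (h.eq x hx ▸ hx0)⟩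

theorem phaseMeasure_eq_top (h : AdaptedChart E p A N ψ r L) {i : Fin (n + 1)} (hA : A ⊆ {i})
    (hN : ∀ q, q i = 0 → N q = 0) {U : Set (PhaseSpace (n + 1))} (hU : U ∈ 𝓝 p) :
    phaseMeasure E U = ∞ := by
  obtain ⟨ρ₀, hρ₀, hρU⟩ := Metric.mem_nhds_iff.1 hU
  set ρ := min ρ₀ r with hρ
  have hρ_pos : 0 < ρ := lt_min hρ₀ h.r_pos
  obtain ⟨s, hs, hsurj⟩ := h.surj ρ hρ_pos
  set S : Set (PhaseSpace (n + 1)) := {x ∈ Metric.ball p ρ | ψ x i = 0} with hSdef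
  have hSr : ∀ x ∈ S, x ∈ Metric.ball p r := fun x hx =>
    Metric.ball_subset_ball (min_le_right _ _) hx.1
  have hSm : MeasurableSet S := Metric.isOpen_ball.measurableSet.inter
    ((measurableSet_singleton (0 : ℝ)).preimage ((measurable_pi_apply i).comp h.measurable))
  -- The Lipschitz projection of `S` contains a ball of `ℝⁿ`, so `S` cannot be null.
  have hpos : μH[(n : ℝ)] S ≠ 0 := by
    intro h0
    have h1 : Metric.ball (0 : Fin n → ℝ) s ⊆ (fun x => dropCoord i (ψ x)) '' S := by
      intro q hq
      have hq' : ‖(Fin.insertNth i 0 q : Fin (n + 1) → ℝ)‖ < s := by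
        refine (pi_norm_lt_iff hs).2 fun k => ?_
        rcases eq_or_ne k i with rfl | hk
        · simpa using hs
        · obtain ⟨j, rfl⟩ := Fin.exists_succAbove_eq hk
          rw [Fin.insertNth_apply_succAbove]
          exact (norm_le_pi_norm q j).trans_lt (by simpa using hq)
      obtain ⟨x, hx, hxq⟩ := hsurj _ hq'
      refine ⟨x, ⟨hx, by simp [hxq]⟩, ?_⟩
      ext j
      simp [dropCoord, hxq]
    have h2 := (measure_mono h1).trans
      ((h.lipschitzOn_dropCoord_comp i S).hausdorffMeasure_image_le n.cast_nonneg)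
    rw [h0, mul_zero, hausdorffMeasure_fin] at h2
    exact (Metric.measure_ball_pos volume (0 : Fin n → ℝ) hs).not_ge h2
  have hgrad : ∀ x ∈ S, gradient E x = 0 := fun x hx => by
    have := h.grad_le x (hSr x hx) 0 le_rfl fun k hk => by
      rw [Finset.mem_singleton.1 (hA hk), hx.2, abs_zero]
    simpa using this
  have hE : S ∩ {x | E x = 0} = S := Set.inter_eq_left.2 fun x hx => by
    rw [Set.mem_ofPred_eq, h.eq x (hSr x hx), hN _ hx.2]
  refine top_unique ?_
  have hSU : S ⊆ U := fun x hx => hρU (Metric.ball_subset_ball (min_le_left _ _) hx.1)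
  refine le_trans ?_ (measure_mono hSU)
  rw [phaseMeasure_apply E hSm, hE, setLIntegral_congr_fun hSm (g := fun _ => ∞) fun x hx => by
    simp [hgrad x hx]]
  simp [hpos]

end AdaptedChart

/-! ### Finiteness in effective dimension larger than two -/

/-- Subtracting the two equations expresses `q i ^ 2 - q' i ^ 2` through the differences of the
other squares. By dominance each of these is at most the projected distance times `|q i| + |q' i|`,
and equal signs make that factor `|q i + q' i|`, which cancels. -/
theorem abs_sub_le_of_quadForm_eq_zero {n : ℕ} {σ : Fin (n + 1) → SignType} {i : Fin (n + 1)}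
    (hi : σ i ≠ 0) {q q' : Fin (n + 1) → ℝ} (hq : quadForm σ q = 0) (hq' : quadForm σ q' = 0)
    (hsign : 0 < q i * q' i) (hdom : ∀ k, σ k ≠ 0 → |q k| ≤ |q i|)
    (hdom' : ∀ k, σ k ≠ 0 → |q' k| ≤ |q' i|) :
    |q i - q' i| ≤ n * dist (dropCoord i q) (dropCoord i q') := by
  set δ := dist (dropCoord i q) (dropCoord i q') with hδ
  have hδ0 : 0 ≤ δ := dist_nonneg
  have habs : |q i + q' i| = |q i| + |q' i| := by
    rcases pos_and_pos_or_neg_and_neg_of_mul_pos hsign with ⟨h1, h2⟩ | ⟨h1, h2⟩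
    · rw [abs_of_pos h1, abs_of_pos h2, abs_of_pos (by linarith)]
    · rw [abs_of_neg h1, abs_of_neg h2, abs_of_neg (by linarith)]; ring
  have hpos : 0 < |q i| + |q' i| := by
    have : q i ≠ 0 := left_ne_zero_of_mul hsign.ne'
    positivity
  have hs : |(σ i : ℝ)| = 1 := by rcases h : σ i <;> simp_all
  have hsum : (σ i : ℝ) * (q i ^ 2 - q' i ^ 2) =
      -∑ j, (σ (i.succAbove j) : ℝ) * (q (i.succAbove j) ^ 2 - q' (i.succAbove j) ^ 2) := by
    unfold quadForm at hq hq'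
    rw [Fin.sum_univ_succAbove _ i] at hq hq'
    simp only [mul_sub, Finset.sum_sub_distrib]
    linarith
  have hterm : ∀ j ∈ (Finset.univ : Finset (Fin n)),
      |(σ (i.succAbove j) : ℝ) * (q (i.succAbove j) ^ 2 - q' (i.succAbove j) ^ 2)| ≤
        δ * (|q i| + |q' i|) := by
    intro j _
    have h1 : |q (i.succAbove j) - q' (i.succAbove j)| ≤ δ :=
      dist_le_pi_dist (dropCoord i q) (dropCoord i q') j
    by_cases h0 : σ (i.succAbove j) = 0
    · simp only [h0, SignType.coe_zero, zero_mul, abs_zero]; positivity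
    · have h2 : |(σ (i.succAbove j) : ℝ)| = 1 := by
        rcases h : σ (i.succAbove j) <;> simp_all
      rw [abs_mul, h2, one_mul, sq_sub_sq, mul_comm, abs_mul]
      gcongr
      exact (abs_add_le _ _).trans (add_le_add (hdom _ h0) (hdom' _ h0))
  have hfin : |q i - q' i| * (|q i| + |q' i|) ≤ n * δ * (|q i| + |q' i|) := by
    calc |q i - q' i| * (|q i| + |q' i|) = |(σ i : ℝ) * (q i ^ 2 - q' i ^ 2)| := by
          rw [abs_mul, hs, one_mul, sq_sub_sq, abs_mul, habs, mul_comm]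
      _ ≤ ∑ _j : Fin n, δ * (|q i| + |q' i|) := by
          rw [hsum, abs_neg]
          exact (Finset.abs_sum_le_sum_abs _ _).trans (Finset.sum_le_sum hterm)
      _ = n * δ * (|q i| + |q' i|) := by simp; ring
  exact le_of_mul_le_mul_right hfin hpos

/-- The integrand is `∞` at `0`, whereas the real power in `lintegral_abs_rpow_lt_top` has the
default value `0` there; the two agree almost everywhere. -/
theorem lintegral_ofReal_abs_rpow_lt_top (R : ℝ) :
    ∫⁻ t in Set.Icc (-R) R, ENNReal.ofReal |t| ^ (-(1 / 2) : ℝ) < ∞ := by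
  refine lt_of_le_of_lt (le_of_eq (lintegral_congr_ae (ae_restrict_of_ae ?_)))
    (lintegral_abs_rpow_lt_top R)
  filter_upwards [(measure_eq_zero_iff_ae_notMem (μ := volume) (s := {(0 : ℝ)})).1 (by simp)]
    with t ht
  exact ENNReal.ofReal_rpow_of_pos (abs_pos.2 ht)

/-- Splitting `G` as `G^(1/2) * G^(1/2)` distributes the singularity `1/|∇E|` over two coordinates,
each with an integrable exponent. -/
theorem ENNReal_inv_le_of_le {G X Y : ℝ≥0∞} (hX : X ≠ ∞) (hY : Y ≠ ∞) (hXG : X ≤ G)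
    (hYG : Y ≤ G) : G⁻¹ ≤ X ^ (-(1 / 2) : ℝ) * Y ^ (-(1 / 2) : ℝ) := by
  rw [ENNReal.rpow_neg, ENNReal.rpow_neg, ← ENNReal.mul_inv
    (Or.inr (ENNReal.rpow_ne_top_of_nonneg (by norm_num) hY))
    (Or.inl (ENNReal.rpow_ne_top_of_nonneg (by norm_num) hX)), ENNReal.inv_le_inv]
  calc X ^ (1 / 2 : ℝ) * Y ^ (1 / 2 : ℝ) ≤ G ^ (1 / 2 : ℝ) * G ^ (1 / 2 : ℝ) := by
        gcongr
    _ = G := by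
        rw [← ENNReal.rpow_add_of_nonneg _ _ (by norm_num) (by norm_num)]
        norm_num

namespace AdaptedChart

variable {n : ℕ} {E : PhaseSpace (n + 1) → ℝ} {p : PhaseSpace (n + 1)}
  {A : Finset (Fin (n + 1))} {N : (Fin (n + 1) → ℝ) → ℝ} {ψ : PhaseSpace (n + 1) → Fin (n + 1) → ℝ}
  {r : ℝ} {L : ℝ≥0}

theorem ofReal_abs_le (h : AdaptedChart E p A N ψ r L) {x : PhaseSpace (n + 1)}
    (hx : x ∈ Metric.ball p r) {k : Fin (n + 1)} (hk : k ∈ A) :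
    ENNReal.ofReal |ψ x k| ≤ L * ‖gradient E x‖ₑ := by
  have := ENNReal.ofReal_le_ofReal (h.le_grad x hx k hk)
  rwa [ENNReal.ofReal_mul L.coe_nonneg, ENNReal.ofReal_coe_nnreal, ofReal_norm] at this

theorem inv_enorm_gradient (h : AdaptedChart E p A N ψ r L) (x : PhaseSpace (n + 1)) :
    ‖gradient E x‖ₑ⁻¹ = L * (L * ‖gradient E x‖ₑ)⁻¹ := by
  have hL : (L : ℝ≥0∞) ≠ 0 := by exact_mod_cast h.L_pos.ne'
  rw [ENNReal.mul_inv (Or.inl hL) (Or.inl ENNReal.coe_ne_top), ← mul_assoc,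
    ENNReal.mul_inv_cancel hL ENNReal.coe_ne_top, one_mul]

/-- Part of the cone `{E = 0}` on which the `i`-th coordinate dominates and has a given sign. -/
def conePiece (E : PhaseSpace (n + 1) → ℝ) (p : PhaseSpace (n + 1)) (A : Finset (Fin (n + 1)))
    (ψ : PhaseSpace (n + 1) → Fin (n + 1) → ℝ) (r : ℝ) (is : Fin (n + 1) × Bool) :
    Set (PhaseSpace (n + 1)) :=
  {x ∈ Metric.ball p r | E x = 0 ∧ is.1 ∈ A ∧ 0 < (if is.2 then ψ x is.1 else -ψ x is.1) ∧
    ∀ k ∈ A, |ψ x k| ≤ |ψ x is.1|}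

/-- The piece is a Lipschitz graph over the coordinates other than `i`. Since more than two
coordinates are active, two active ones survive the projection, and each carries half of the
singularity. -/
theorem lintegral_conePiece_lt_top {σ : Fin (n + 1) → SignType}
    (h : AdaptedChart E p (Finset.univ.filter fun i => σ i ≠ 0) (quadForm σ) ψ r L)
    (hcard : 2 < (Finset.univ.filter fun i => σ i ≠ 0).card) (is : Fin (n + 1) × Bool) :
    ∫⁻ x in conePiece E p (Finset.univ.filter fun i => σ i ≠ 0) ψ r is,
      ‖gradient E x‖ₑ⁻¹ ∂μH[(n : ℝ)] < ∞ := by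
  obtain ⟨i, s⟩ := is
  set A := Finset.univ.filter fun i => σ i ≠ 0 with hA
  by_cases hiA : i ∈ A
  swap
  · have : conePiece E p A ψ r (i, s) = ∅ := Set.eq_empty_iff_forall_notMem.2
      fun x hx => hiA hx.2.2.1
    simp [this]
  have hσ : ∀ k, σ k ≠ 0 → k ∈ A := fun k hk => by simpa [hA] using hk
  have hcard' : 1 < (A.erase i).card := by rw [Finset.card_erase_of_mem hiA]; omega
  obtain ⟨a, ha, b, hb, hab⟩ := Finset.one_lt_card.1 hcard'
  rw [Finset.mem_erase] at ha hb
  obtain ⟨a', rfl⟩ := Fin.exists_succAbove_eq ha.1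
  obtain ⟨b', rfl⟩ := Fin.exists_succAbove_eq hb.1
  have hab' : a' ≠ b' := fun h => hab (h ▸ rfl)
  -- The graph has slope at most `n`; `n + 1` is used because the constant has to be at least `1`.
  have hanti := h.dist_le_dropCoord (i := i) (c := (n + 1 : ℕ)) (by simp)
    (S := conePiece E p A ψ r (i, s)) (fun x hx => hx.1) (fun x hx y hy => by
      refine (abs_sub_le_of_quadForm_eq_zero (σ := σ) (i := i) (by simpa [hA] using hiA)
        (h.eq x hx.1 ▸ hx.2.1) (h.eq y hy.1 ▸ hy.2.1) ?_ (fun k hk => hx.2.2.2.2 k (hσ k hk))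
        (fun k hk => hy.2.2.2.2 k (hσ k hk))).trans ?_
      · have h1 := hx.2.2.2.1
        have h2 := hy.2.2.2.1
        cases s
        · simpa using mul_pos h1 h2
        · simpa using mul_pos h1 h2
      · gcongr
        push_cast
        linarith)
  set R : ℝ := L * r with hR
  set w : ℝ → ℝ≥0∞ := fun t => ENNReal.ofReal |t| ^ (-(1 / 2) : ℝ) with hw
  have hwm : Measurable w := by fun_prop
  set F : Fin n → ℝ → ℝ≥0∞ := fun j => (Set.Icc (-R) R).indicator
    (if j = a' ∨ j = b' then w else 1) with hF
  have hFm : ∀ j, Measurable (F j) := fun j => Measurable.indicator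
    (by split_ifs; exacts [hwm, measurable_const]) measurableSet_Icc
  have hbound : ∀ x ∈ conePiece E p A ψ r (i, s),
      ‖gradient E x‖ₑ⁻¹ ≤ L * ∏ j, F j (dropCoord i (ψ x) j) := by
    intro x hx
    rw [h.inv_enorm_gradient]
    gcongr
    have hval : ∀ j, F j (dropCoord i (ψ x) j) =
        if j = a' ∨ j = b' then w (dropCoord i (ψ x) j) else 1 := by
      intro j
      have hm : dropCoord i (ψ x) j ∈ Set.Icc (-R) R := by
        rw [Set.mem_Icc, ← abs_le]
        refine (h.abs_apply_le x _).trans ?_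
        have := hx.1
        rw [hR]
        gcongr
        exact (Metric.mem_ball.1 this).le
      simp only [hF]
      rw [Set.indicator_of_mem hm]
      split_ifs <;> rfl
    have hprod : ∏ j, F j (dropCoord i (ψ x) j) =
        w (ψ x (i.succAbove a')) * w (ψ x (i.succAbove b')) := by
      rw [Finset.prod_congr rfl fun j _ => hval j,
        Finset.prod_eq_mul a' b' hab' (fun c _ hc => by simp [hc.1, hc.2]) (by simp) (by simp)]
      simp [dropCoord]
    rw [hprod]
    exact ENNReal_inv_le_of_le ENNReal.ofReal_ne_top ENNReal.ofReal_ne_top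
      (h.ofReal_abs_le hx.1 ha.2) (h.ofReal_abs_le hx.1 hb.2)
  have hm : Measurable fun q : Fin n → ℝ => ∏ j, F j (q j) :=
    Finset.measurable_prod _ fun j _ => (hFm j).comp (measurable_pi_apply j)
  have hlt : ∫⁻ q : Fin n → ℝ, ∏ j, F j (q j) < ∞ := by
    rw [lintegral_fin_prod F hFm]
    refine ENNReal.prod_lt_top fun j _ => ?_
    rw [lintegral_indicator measurableSet_Icc]
    split_ifs
    · exact lintegral_ofReal_abs_rpow_lt_top R
    · simp
  calc ∫⁻ x in conePiece E p A ψ r (i, s), ‖gradient E x‖ₑ⁻¹ ∂μH[(n : ℝ)]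
      ≤ ∫⁻ x in conePiece E p A ψ r (i, s), L * ∏ j, F j (dropCoord i (ψ x) j) ∂μH[(n : ℝ)] :=
        setLIntegral_mono ((hm.comp (h.measurable_dropCoord_comp i)).const_mul _) hbound
    _ = L * ∫⁻ x in conePiece E p A ψ r (i, s), ∏ j, F j (dropCoord i (ψ x) j) ∂μH[(n : ℝ)] :=
        lintegral_const_mul _ (hm.comp (h.measurable_dropCoord_comp i))
    _ ≤ L * (((L * (n + 1 : ℕ) : ℝ≥0) : ℝ≥0∞) ^ (n : ℝ) *
          ∫⁻ (q : Fin n → ℝ) in Set.univ, ∏ j, F j (q j) ∂μH[(n : ℝ)]) := by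
        gcongr
        exact setLIntegral_comp_le_of_antilipschitzOn n.cast_nonneg
          (h.measurable_dropCoord_comp i) hanti (Set.mapsTo_univ _ _) hm
    _ < ∞ := by
        rw [hausdorffMeasure_fin, setLIntegral_univ]
        exact ENNReal.mul_lt_top ENNReal.coe_lt_top (ENNReal.mul_lt_top
          (ENNReal.rpow_lt_top_of_nonneg n.cast_nonneg ENNReal.coe_ne_top) hlt)

theorem phaseMeasure_ball_lt_top {σ : Fin (n + 1) → SignType}
    (h : AdaptedChart E p (Finset.univ.filter fun i => σ i ≠ 0) (quadForm σ) ψ r L)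
    (hcard : 2 < (Finset.univ.filter fun i => σ i ≠ 0).card) :
    phaseMeasure E (Metric.ball p r) < ∞ := by
  set A := Finset.univ.filter fun i => σ i ≠ 0 with hA
  obtain ⟨a, ha, b, hb, hab⟩ := Finset.one_lt_card.1 (by omega : 1 < A.card)
  rw [phaseMeasure_apply E Metric.isOpen_ball.measurableSet]
  -- A zero either has a nonzero dominating active coordinate, hence lies in a cone piece, or has
  -- all active coordinates zero, hence lies in a null set.
  have hcover : Metric.ball p r ∩ {x | E x = 0} ⊆
      {x ∈ Metric.ball p r | ψ x a = 0 ∧ ψ x b = 0} ∪ ⋃ is, conePiece E p A ψ r is := by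
    rintro x ⟨hx, hx0⟩
    obtain ⟨i, hi, hmax⟩ := A.exists_max_image (fun k => |ψ x k|) ⟨a, ha⟩
    rcases lt_trichotomy (ψ x i) 0 with h1 | h1 | h1
    · exact Or.inr (Set.mem_iUnion.2 ⟨(i, false), hx, hx0, hi, by simpa using h1, hmax⟩)
    · left
      have hz : ∀ k ∈ A, ψ x k = 0 := fun k hk => by
        have := hmax k hk
        rw [h1, abs_zero] at this
        exact abs_nonpos_iff.1 this
      exact ⟨hx, hz a ha, hz b hb⟩
    · exact Or.inr (Set.mem_iUnion.2 ⟨(i, true), hx, hx0, hi, by simpa using h1, hmax⟩)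
  refine (lintegral_mono_set hcover).trans_lt ((lintegral_union_le _ _ _).trans_lt ?_)
  rw [setLIntegral_measure_zero _ _ (h.hausdorffMeasure_codim_two hab.symm), zero_add]
  refine (lintegral_iUnion_le _ _).trans_lt ?_
  rw [tsum_fintype]
  exact ENNReal.sum_lt_top.2 fun is _ => h.lintegral_conePiece_lt_top hcard is

end AdaptedChart

/-! ### Tools for logarithmic divergence -/

/-- As `log (1 / ε) → ∞`, the additive constants `log a₁` and `log a₂` are absorbed by halving or
doubling the prefactors. The `min` with `1` handles `K₁ = ∞`, and the added `1` keeps `C` positive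
when `K₂ = 0`. -/
theorem LogDivergent.of_le_of_le {f : ℝ → ℝ≥0∞} {K₁ K₂ : ℝ≥0∞} {a₁ a₂ : ℝ} (hK₁ : K₁ ≠ 0)
    (hK₂ : K₂ ≠ ∞) (ha₁ : 0 < a₁) (ha₂ : 0 < a₂)
    (h₁ : ∀ᶠ ε in 𝓝[>] (0 : ℝ), K₁ * ENNReal.ofReal (Real.log (a₁ / ε)) ≤ f ε)
    (h₂ : ∀ᶠ ε in 𝓝[>] (0 : ℝ), f ε ≤ K₂ * ENNReal.ofReal (Real.log (a₂ / ε))) :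
    LogDivergent f := by
  have hK : (min K₁ 1).toReal ≠ 0 :=
    ENNReal.toReal_ne_zero.2 ⟨by simp [hK₁], by simp⟩
  have hK' : 0 < (min K₁ 1).toReal := lt_of_le_of_ne ENNReal.toReal_nonneg hK.symm
  have htend : Tendsto (fun ε : ℝ => Real.log (1 / ε)) (𝓝[>] 0) atTop := by
    simp only [one_div]
    exact Real.tendsto_log_atTop.comp tendsto_inv_nhdsGT_zero
  refine ⟨(min K₁ 1).toReal / 2, (K₂.toReal + 1) * 2, by positivity, by positivity, ?_⟩
  filter_upwards [h₁, h₂, self_mem_nhdsWithin, htend.eventually_ge_atTop (-2 * Real.log a₁),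
    htend.eventually_ge_atTop (Real.log a₂), htend.eventually_ge_atTop 0]
    with ε h₁ h₂ hε hl₁ hl₂ hl
  have hε : (0 : ℝ) < ε := hε
  have hlog : ∀ a : ℝ, 0 < a → Real.log (a / ε) = Real.log a + Real.log (1 / ε) := fun a ha => by
    rw [← Real.log_mul ha.ne' (by positivity), mul_one_div]
  constructor
  · refine le_trans ?_ h₁
    rw [hlog a₁ ha₁, div_mul_eq_mul_div, mul_div_assoc, ENNReal.ofReal_mul hK'.le,
      ENNReal.ofReal_toReal (by simp)]
    gcongr
    · exact min_le_left _ _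
    · linarith
  · refine h₂.trans ?_
    rw [hlog a₂ ha₂, mul_assoc, ENNReal.ofReal_mul (by positivity)]
    gcongr
    · rw [ENNReal.ofReal_add ENNReal.toReal_nonneg zero_le_one, ENNReal.ofReal_toReal hK₂]
      exact le_self_add
    · linarith

theorem LogDivergent.tendsto_top {f : ℝ → ℝ≥0∞} (h : LogDivergent f) {M : ℝ≥0∞}
    (hM : ∀ᶠ ε in 𝓝[>] (0 : ℝ), f ε ≤ M) : M = ∞ := by
  obtain ⟨c, C, hc, -, h⟩ := h
  have htend : Tendsto (fun ε : ℝ => c * Real.log (1 / ε)) (𝓝[>] 0) atTop := by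
    simp only [one_div]
    exact (Real.tendsto_log_atTop.comp tendsto_inv_nhdsGT_zero).const_mul_atTop hc
  refine top_unique (le_of_tendsto (ENNReal.tendsto_ofReal_atTop.comp htend) ?_)
  filter_upwards [h, hM] with ε h1 h2 using h1.1.trans h2

theorem lintegral_fin_prod_single {n : ℕ} (b : Fin n) {F G : ℝ → ℝ≥0∞} (hF : Measurable F)
    (hG : Measurable G) :
    ∫⁻ q : Fin n → ℝ, ∏ j, (if j = b then F (q j) else G (q j)) =
      (∫⁻ t, F t) * (∫⁻ t, G t) ^ (n - 1) := by
  have h := lintegral_fin_prod (fun j : Fin n => if j = b then F else G)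
    fun j => by split_ifs <;> assumption
  simp only [ite_apply] at h
  rw [h, Fintype.prod_eq_mul_prod_compl b]
  simp only [if_true]
  congr 1
  rw [Finset.prod_congr rfl (g := fun _ => ∫⁻ t, G t) fun j hj => by
    simp only [if_neg (by simpa using hj : ¬j = b)]]
  simp [Finset.card_compl]

theorem measurable_fin_prod_single {n : ℕ} (b : Fin n) {F G : ℝ → ℝ≥0∞} (hF : Measurable F)
    (hG : Measurable G) :
    Measurable fun q : Fin n → ℝ => ∏ j, (if j = b then F (q j) else G (q j)) :=
  Finset.measurable_prod _ fun j _ => by split_ifs <;> fun_prop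

theorem lintegral_fin_eq_insertNth {n : ℕ} (a : Fin (n + 1)) {F : (Fin (n + 1) → ℝ) → ℝ≥0∞}
    (hF : Measurable F) :
    ∫⁻ q, F q = ∫⁻ q' : Fin n → ℝ, ∫⁻ u : ℝ, F (a.insertNth u q') := by
  have h := (volume_preserving_piFinSuccAbove (fun _ : Fin (n + 1) => ℝ) a).symm
  rw [← h.lintegral_comp hF, Measure.volume_eq_prod]
  exact lintegral_prod_symm' _ (hF.comp h.measurable)

/-! ### Volume in the chart, distance to the critical set, and the phase measure along one
hyperplane. -/

namespace AdaptedChart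

variable {n : ℕ} {E : PhaseSpace (n + 1) → ℝ} {p : PhaseSpace (n + 1)}
  {A : Finset (Fin (n + 1))} {N : (Fin (n + 1) → ℝ) → ℝ} {ψ : PhaseSpace (n + 1) → Fin (n + 1) → ℝ}
  {r : ℝ} {L : ℝ≥0}

theorem setLIntegral_comp_le (h : AdaptedChart E p A N ψ r L) :
    ∃ K : ℝ≥0∞, K ≠ ∞ ∧ ∀ S ⊆ Metric.ball p r, MeasurableSet S →
      ∀ f : (Fin (n + 1) → ℝ) → ℝ≥0∞, Measurable f →
        ∫⁻ x in S, f (ψ x) ≤ K * ∫⁻ q, f q := by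
  refine ⟨(L : ℝ≥0∞) ^ ((n + 1 : ℕ) : ℝ),
    (ENNReal.rpow_lt_top_of_nonneg (Nat.cast_nonneg _) ENNReal.coe_ne_top).ne,
    fun S hS hSm f hf => ?_⟩
  -- Euclidean volume is first moved to `Fin (n + 1) → ℝ`, where it is the Hausdorff measure to
  -- which the Lipschitz comparison applies.
  have hmp := PiLp.volume_preserving_toLp (Fin (n + 1))
  refine (hmp.setLIntegral_comp_preimage hSm (hf.comp h.measurable)).symm.trans_le ?_
  rw [← setLIntegral_univ f, ← hausdorffMeasure_fin]
  refine setLIntegral_comp_le_of_antilipschitzOn (Nat.cast_nonneg _)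
    (g := fun y => ψ (WithLp.toLp 2 y)) (h.measurable.comp hmp.measurable) ?_
    (Set.mapsTo_univ _ _) hf
  intro x hx y hy
  refine le_trans ?_ (h.antilip _ (hS hx) _ (hS hy))
  simpa using (PiLp.lipschitzWith_ofLp 2 (fun _ : Fin (n + 1) => ℝ)).dist_le_mul
    (WithLp.toLp 2 x) (WithLp.toLp 2 y)

theorem le_setLIntegral_comp (h : AdaptedChart E p A N ψ r L) :
    ∃ K : ℝ≥0∞, K ≠ ∞ ∧ ∀ S, MeasurableSet S → ∀ T ⊆ ψ '' S,
      ∀ f : (Fin (n + 1) → ℝ) → ℝ≥0∞, Measurable f →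
        ∫⁻ q in T, f q ≤ K * ∫⁻ x in S, f (ψ x) := by
  have hlip := h.lip.comp (PiLp.lipschitzWith_toLp 2 (fun _ : Fin (n + 1) => ℝ))
  set c : ℝ≥0 := L * (Fintype.card (Fin (n + 1)) : ℝ≥0) ^ (1 / (2 : ℝ≥0∞)).toReal
  refine ⟨(c : ℝ≥0∞) ^ ((n + 1 : ℕ) : ℝ),
    (ENNReal.rpow_lt_top_of_nonneg (Nat.cast_nonneg _) ENNReal.coe_ne_top).ne,
    fun S hSm T hT f hf => ?_⟩
  have hmp := PiLp.volume_preserving_toLp (Fin (n + 1))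
  refine le_of_le_of_eq ?_ (congrArg _ (hmp.setLIntegral_comp_preimage hSm (hf.comp h.measurable)))
  rw [← hausdorffMeasure_fin]
  refine setLIntegral_le_comp_of_lipschitzOn (Nat.cast_nonneg _)
    (g := fun y => ψ (WithLp.toLp 2 y)) (h.measurable.comp hmp.measurable)
    hlip.lipschitzOnWith ?_ hf
  intro q hq
  obtain ⟨x, hx, rfl⟩ := hT hq
  exact ⟨x.ofLp, hx, rfl⟩

/-- Near `p`, the distance to the critical set is comparable to the size of the coordinates
in `A`. -/
theorem exists_infDist_bounds (h : AdaptedChart E p A N ψ r L)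
    (hN : ∀ q, (∀ k ∈ A, q k = 0) → N q = 0) :
    ∃ η₀ > 0, η₀ ≤ r ∧ ∀ x ∈ Metric.ball p η₀,
      (∀ k ∈ A, |ψ x k| ≤ L * Metric.infDist x (criticalSet E)) ∧
      ∀ M : ℝ, (∀ k ∈ A, |ψ x k| ≤ M) → 0 ≤ M → Metric.infDist x (criticalSet E) ≤ L * M := by
  have hcrit : ∀ y ∈ Metric.ball p r, (∀ k ∈ A, ψ y k = 0) → y ∈ criticalSet E := by
    intro y hy h0
    refine ⟨by rw [h.eq y hy, hN _ h0], h.diff y hy, ?_⟩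
    have := h.grad_le y hy 0 le_rfl fun k hk => by rw [h0 k hk, abs_zero]
    simpa using this
  have hpC : p ∈ criticalSet E := hcrit p (Metric.mem_ball_self h.r_pos) fun k _ => by
    rw [h.map_base]; rfl
  obtain ⟨s, hs, hsurj⟩ := h.surj r h.r_pos
  have hL : (0 : ℝ) < L := by exact_mod_cast h.L_pos
  have hr := h.r_pos
  -- Radius `r / 2` makes critical points outside the chart ball at least as far from `x` as `p` is;
  -- radius `s / L` keeps coordinates within the range reached by `surj`.
  refine ⟨min (r / 2) (s / L), by positivity, (min_le_left _ _).trans (by linarith),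
    fun x hx => ⟨fun k hk => ?_, fun M hM hM0 => ?_⟩⟩
  · have hx1 : dist x p < r / 2 := (Metric.mem_ball.1 hx).trans_le (min_le_left _ _)
    rw [← div_le_iff₀' hL]
    refine (Metric.le_infDist ⟨p, hpC⟩).2 fun y hy => ?_
    rw [div_le_iff₀' hL]
    by_cases hyr : y ∈ Metric.ball p r
    · have hy0 : ψ y k = 0 := by
        have := h.le_grad y hyr k hk
        rw [hy.2.2, norm_zero, mul_zero] at this
        exact abs_nonpos_iff.1 this
      have := (dist_le_pi_dist (ψ x) (ψ y) k).trans (h.lip.dist_le_mul x y)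
      rwa [hy0, dist_zero_right] at this
    · refine (h.abs_apply_le x k).trans ?_
      gcongr
      have h1 := dist_triangle_left y p x
      rw [Metric.mem_ball, not_lt] at hyr
      linarith
  · have hx1 : x ∈ Metric.ball p r := Metric.ball_subset_ball
      ((min_le_left _ _).trans (by linarith)) hx
    have hx2 : L * dist x p < s := by
      rw [← lt_div_iff₀' hL]
      exact (Metric.mem_ball.1 hx).trans_le (min_le_right _ _)
    -- The competitor for the distance is the critical point obtained from `x` by setting the active
    -- coordinates to zero.
    obtain ⟨y, hy, hyq⟩ := hsurj (fun k => if k ∈ A then 0 else ψ x k) <|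
      (pi_norm_lt_iff hs).2 fun k => by
        split_ifs
        · simpa using hs
        · exact (h.abs_apply_le x k).trans_lt hx2
    have hyC : y ∈ criticalSet E := hcrit y hy fun k hk => by rw [hyq]; simp [hk]
    refine (Metric.infDist_le_dist_of_mem hyC).trans ((h.antilip x hx1 y hy).trans ?_)
    gcongr
    refine (dist_pi_le_iff hM0).2 fun k => ?_
    simp only [hyq]
    split_ifs with hk
    · simpa using hM k hk
    · simpa using hM0

/-- After dropping `q a`, the density is at most `L² / |q b|` up to the measure distortion's
normalisation: one factor gives the logarithm over `δ ≤ |q b| ≤ L r` and the other coordinates give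
powers of the box length. -/
theorem setLIntegral_inv_gradient_le (h : AdaptedChart E p A N ψ r L) {a b : Fin (n + 1)}
    (hab : b ≠ a) (hb : b ∈ A) :
    ∃ K : ℝ≥0∞, K ≠ ∞ ∧ ∀ δ : ℝ, 0 < δ → δ ≤ L * r →
      ∫⁻ x in {x ∈ Metric.ball p r | ψ x a = 0 ∧ δ ≤ |ψ x b|}, ‖gradient E x‖ₑ⁻¹ ∂μH[(n : ℝ)] ≤
        K * ENNReal.ofReal (Real.log (L * r / δ)) := by
  obtain ⟨b', rfl⟩ := Fin.exists_succAbove_eq hab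
  set R : ℝ := L * r with hR
  refine ⟨L * ((L : ℝ≥0∞) ^ (n : ℝ) * (2 * ENNReal.ofReal (2 * R) ^ (n - 1))), ?_,
    fun δ hδ hδR => ?_⟩
  · refine (ENNReal.mul_lt_top ENNReal.coe_lt_top (ENNReal.mul_lt_top
      (ENNReal.rpow_lt_top_of_nonneg n.cast_nonneg ENNReal.coe_ne_top)
      (ENNReal.mul_lt_top (by simp) (ENNReal.pow_lt_top ENNReal.ofReal_lt_top)))).ne
  set S := {x ∈ Metric.ball p r | ψ x a = 0 ∧ δ ≤ |ψ x (a.succAbove b')|} with hS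
  have hanti := h.dist_le_dropCoord (i := a) (c := 1) le_rfl (S := S) (fun x hx => hx.1)
    (fun x hx y hy => by rw [hx.2.1, hy.2.1]; simp)
  have hmeas : MeasurableSet {t : ℝ | δ ≤ |t| ∧ |t| ≤ R} :=
    measurableSet_Icc.preimage (f := fun t : ℝ => |t|) (by fun_prop)
  set F : ℝ → ℝ≥0∞ := {t : ℝ | δ ≤ |t| ∧ |t| ≤ R}.indicator fun t => ENNReal.ofReal |t|⁻¹ with hF
  set G : ℝ → ℝ≥0∞ := (Set.Icc (-R) R).indicator 1 with hG
  have hFm : Measurable F := Measurable.indicator (by fun_prop) hmeas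
  have hGm : Measurable G := Measurable.indicator measurable_const measurableSet_Icc
  have hm := measurable_fin_prod_single b' hFm hGm
  have hbound : ∀ x ∈ S, ‖gradient E x‖ₑ⁻¹ ≤
      L * ∏ j, (if j = b' then F (dropCoord a (ψ x) j) else G (dropCoord a (ψ x) j)) := by
    intro x hx
    have hbox : ∀ k, |ψ x k| ≤ R := fun k => (h.abs_apply_le x k).trans <| by
      rw [hR]; gcongr; exact (Metric.mem_ball.1 hx.1).le
    rw [h.inv_enorm_gradient, Finset.prod_eq_single b' (fun j _ hj => by
      rw [if_neg hj, hG, Set.indicator_of_mem (show dropCoord a (ψ x) j ∈ Set.Icc (-R) R from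
        Set.mem_Icc.2 (abs_le.1 (hbox _)))]; rfl) (by simp),
      if_pos rfl, hF, Set.indicator_of_mem (show dropCoord a (ψ x) b' ∈ {t : ℝ | δ ≤ |t| ∧ |t| ≤ R} from
        ⟨hx.2.2, hbox _⟩),
      show dropCoord a (ψ x) b' = ψ x (a.succAbove b') from rfl,
      ENNReal.ofReal_inv_of_pos (hδ.trans_le hx.2.2)]
    gcongr
    exact h.ofReal_abs_le hx.1 hb
  calc ∫⁻ x in S, ‖gradient E x‖ₑ⁻¹ ∂μH[(n : ℝ)]
      ≤ ∫⁻ x in S, L * ∏ j, (if j = b' then F (dropCoord a (ψ x) j)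
          else G (dropCoord a (ψ x) j)) ∂μH[(n : ℝ)] :=
        setLIntegral_mono ((hm.comp (h.measurable_dropCoord_comp a)).const_mul _) hbound
    _ = L * ∫⁻ x in S, ∏ j, (if j = b' then F (dropCoord a (ψ x) j)
          else G (dropCoord a (ψ x) j)) ∂μH[(n : ℝ)] :=
        lintegral_const_mul _ (hm.comp (h.measurable_dropCoord_comp a))
    _ ≤ L * (((L * 1 : ℝ≥0) : ℝ≥0∞) ^ (n : ℝ) * ∫⁻ (q : Fin n → ℝ) in Set.univ,
          ∏ j, (if j = b' then F (q j) else G (q j)) ∂μH[(n : ℝ)]) := by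
        gcongr
        exact setLIntegral_comp_le_of_antilipschitzOn n.cast_nonneg
          (h.measurable_dropCoord_comp a) hanti (Set.mapsTo_univ _ _) hm
    _ = L * ((L : ℝ≥0∞) ^ (n : ℝ) * ((∫⁻ t, F t) * ENNReal.ofReal (2 * R) ^ (n - 1))) := by
        rw [hausdorffMeasure_fin, setLIntegral_univ, lintegral_fin_prod_single b' hFm hGm, mul_one,
          hG, lintegral_indicator_one measurableSet_Icc, Real.volume_Icc]
        ring_nf
    _ ≤ L * ((L : ℝ≥0∞) ^ (n : ℝ) * (ENNReal.ofReal (2 * Real.log (R / δ)) *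
          ENNReal.ofReal (2 * R) ^ (n - 1))) := by
        gcongr
        rw [hF, lintegral_indicator hmeas]
        exact lintegral_abs_inv_le hδ hδR
    _ = _ := by
        rw [ENNReal.ofReal_mul (by norm_num : (0 : ℝ) ≤ 2), ENNReal.ofReal_ofNat]
        ring

/-- With no active coordinates besides `a` and `b`, the gradient on `q a = 0` is at most `L |q b|`.
The Lipschitz projection covers a box, and its half `q b > 0` already yields the logarithm. -/
theorem le_setLIntegral_inv_gradient (h : AdaptedChart E p A N ψ r L) {a b : Fin (n + 1)}
    (hab : b ≠ a) (hA : A ⊆ {a, b}) {η : ℝ} (hη : 0 < η) (hηr : η ≤ r) :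
    ∃ K : ℝ≥0∞, K ≠ 0 ∧ ∃ R > 0, ∀ δ : ℝ, 0 < δ → δ ≤ R →
      K * ENNReal.ofReal (Real.log (R / δ)) ≤
        ∫⁻ x in {x ∈ Metric.ball p η | ψ x a = 0 ∧ δ ≤ |ψ x b|}, ‖gradient E x‖ₑ⁻¹ ∂μH[(n : ℝ)] := by
  obtain ⟨b', rfl⟩ := Fin.exists_succAbove_eq hab
  obtain ⟨s, hs, hsurj⟩ := h.surj η hη
  set R : ℝ := s / 2 with hR
  have hRpos : 0 < R := by positivity
  have hL : (L : ℝ≥0∞) ≠ 0 := by exact_mod_cast h.L_pos.ne'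
  have hLn : (L : ℝ≥0∞) ^ (n : ℝ) ≠ ∞ :=
    (ENNReal.rpow_lt_top_of_nonneg n.cast_nonneg ENNReal.coe_ne_top).ne
  have hLn0 : (L : ℝ≥0∞) ^ (n : ℝ) ≠ 0 := (ENNReal.rpow_pos (by positivity) ENNReal.coe_ne_top).ne'
  refine ⟨(L : ℝ≥0∞)⁻¹ * ((L : ℝ≥0∞) ^ (n : ℝ))⁻¹ * ENNReal.ofReal (2 * R) ^ (n - 1), ?_, R, hRpos,
    fun δ hδ hδR => ?_⟩
  · refine mul_ne_zero (mul_ne_zero (ENNReal.inv_ne_zero.2 ENNReal.coe_ne_top)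
      (ENNReal.inv_ne_zero.2 hLn)) (pow_ne_zero _ ?_)
    rw [Ne, ENNReal.ofReal_eq_zero, not_le]
    positivity
  set S := {x ∈ Metric.ball p η | ψ x a = 0 ∧ δ ≤ |ψ x (a.succAbove b')|} with hS
  have hSr : ∀ x ∈ S, x ∈ Metric.ball p r := fun x hx => Metric.ball_subset_ball hηr hx.1
  set F : ℝ → ℝ≥0∞ := (Set.Icc δ R).indicator fun t => ENNReal.ofReal t⁻¹ with hF
  set G : ℝ → ℝ≥0∞ := (Set.Icc (-R) R).indicator 1 with hG
  have hFm : Measurable F := Measurable.indicator (by fun_prop) measurableSet_Icc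
  have hGm : Measurable G := Measurable.indicator measurable_const measurableSet_Icc
  have hm := measurable_fin_prod_single b' hFm hGm
  set T : Set (Fin n → ℝ) := {q | (∀ j, q j ∈ Set.Icc (-R) R) ∧ δ ≤ q b'} with hT
  have hTm : MeasurableSet T :=
    (measurableSet_box R).inter (measurableSet_le measurable_const (measurable_pi_apply b'))
  have hsupp : ∀ q : Fin n → ℝ, ∏ j, (if j = b' then F (q j) else G (q j)) ≤
      T.indicator (fun q => ∏ j, (if j = b' then F (q j) else G (q j))) q := by
    intro q
    by_cases hq : q ∈ T
    · rw [Set.indicator_of_mem hq]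
    · rw [Set.indicator_of_notMem hq, nonpos_iff_eq_zero, Finset.prod_eq_zero_iff]
      by_contra! hne
      refine hq ⟨fun j => ?_, ?_⟩
      · have := hne j (Finset.mem_univ _)
        split_ifs at this with hj
        · have := Set.mem_of_indicator_ne_zero this
          exact ⟨by linarith [this.1], this.2⟩
        · exact Set.mem_of_indicator_ne_zero this
      · have := hne b' (Finset.mem_univ _)
        rw [if_pos rfl] at this
        exact (Set.mem_of_indicator_ne_zero this).1
  have hTS : T ⊆ (fun x => dropCoord a (ψ x)) '' S := by
    rintro q ⟨hq, hqb⟩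
    have hq' : ‖(Fin.insertNth a 0 q : Fin (n + 1) → ℝ)‖ < s := by
      refine (pi_norm_lt_iff hs).2 fun k => ?_
      rcases eq_or_ne k a with rfl | hk
      · simpa using hs
      · obtain ⟨j, rfl⟩ := Fin.exists_succAbove_eq hk
        rw [Fin.insertNth_apply_succAbove]
        exact (abs_le.2 (hq j)).trans_lt (by linarith)
    obtain ⟨x, hx, hxq⟩ := hsurj _ hq'
    refine ⟨x, ⟨hx, by simp [hxq], ?_⟩, ?_⟩
    · rw [hxq, Fin.insertNth_apply_succAbove]
      exact hqb.trans (le_abs_self _)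
    · ext j
      simp [dropCoord, hxq]
  have hbound : ∀ x ∈ S, (L : ℝ≥0∞)⁻¹ *
      ∏ j, (if j = b' then F (dropCoord a (ψ x) j) else G (dropCoord a (ψ x) j)) ≤
        ‖gradient E x‖ₑ⁻¹ := by
    intro x hx
    have hpos : 0 < |ψ x (a.succAbove b')| := hδ.trans_le hx.2.2
    have hgrad : ‖gradient E x‖ₑ ≤ L * ENNReal.ofReal |ψ x (a.succAbove b')| := by
      have := h.grad_le x (hSr x hx) |ψ x (a.succAbove b')| (abs_nonneg _) fun k hk => by
        rcases Finset.mem_insert.1 (hA hk) with rfl | hk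
        · rw [hx.2.1, abs_zero]; exact abs_nonneg _
        · rw [Finset.mem_singleton.1 hk]
      have := ENNReal.ofReal_le_ofReal this
      rwa [ENNReal.ofReal_mul L.coe_nonneg, ENNReal.ofReal_coe_nnreal, ofReal_norm] at this
    refine le_trans ?_ (ENNReal.inv_le_inv.2 hgrad)
    rw [ENNReal.mul_inv (Or.inl hL) (Or.inl ENNReal.coe_ne_top)]
    gcongr
    rw [Fintype.prod_eq_mul_prod_compl b', if_pos rfl, ← ENNReal.ofReal_inv_of_pos hpos]
    calc _ ≤ ENNReal.ofReal |ψ x (a.succAbove b')|⁻¹ * 1 := by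
          gcongr
          · rw [hF]
            refine Set.indicator_apply_le' (fun hmem => ?_) fun _ => zero_le
            rw [abs_of_pos (show 0 < ψ x (a.succAbove b') from hδ.trans_le hmem.1)]
            rfl
          · refine Finset.prod_le_one' fun j hj => ?_
            rw [if_neg (by simpa using hj)]
            exact Set.indicator_apply_le' (fun _ => le_rfl) fun _ => zero_le
      _ = _ := mul_one _
  have hSm : MeasurableSet S := Metric.isOpen_ball.measurableSet.inter
    (((measurableSet_singleton (0 : ℝ)).preimage ((measurable_pi_apply a).comp h.measurable)).inter
      (measurableSet_le measurable_const
        ((measurable_pi_apply (a.succAbove b')).comp h.measurable).abs))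
  have hint : ∫⁻ q : Fin n → ℝ, ∏ j, (if j = b' then F (q j) else G (q j)) =
      ENNReal.ofReal (Real.log (R / δ)) * ENNReal.ofReal (2 * R) ^ (n - 1) := by
    rw [lintegral_fin_prod_single b' hFm hGm, hG, lintegral_indicator_one measurableSet_Icc,
      Real.volume_Icc, hF, lintegral_indicator measurableSet_Icc, lintegral_Icc_inv hδ hδR]
    ring_nf
  have hmain : ∫⁻ q : Fin n → ℝ, ∏ j, (if j = b' then F (q j) else G (q j)) ≤
      (L : ℝ≥0∞) ^ (n : ℝ) * ∫⁻ x in S, ∏ j, (if j = b' then F (dropCoord a (ψ x) j)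
          else G (dropCoord a (ψ x) j)) ∂μH[(n : ℝ)] := by
    refine (lintegral_mono hsupp).trans ?_
    rw [lintegral_indicator hTm, ← hausdorffMeasure_fin]
    exact setLIntegral_le_comp_of_lipschitzOn n.cast_nonneg (h.measurable_dropCoord_comp a)
      (h.lipschitzOn_dropCoord_comp a S) hTS hm
  rw [hint] at hmain
  calc (L : ℝ≥0∞)⁻¹ * ((L : ℝ≥0∞) ^ (n : ℝ))⁻¹ * ENNReal.ofReal (2 * R) ^ (n - 1) *
        ENNReal.ofReal (Real.log (R / δ))
      = (L : ℝ≥0∞)⁻¹ * (((L : ℝ≥0∞) ^ (n : ℝ))⁻¹ * (ENNReal.ofReal (Real.log (R / δ)) *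
          ENNReal.ofReal (2 * R) ^ (n - 1))) := by ring
    _ ≤ (L : ℝ≥0∞)⁻¹ * (((L : ℝ≥0∞) ^ (n : ℝ))⁻¹ * ((L : ℝ≥0∞) ^ (n : ℝ) *
          ∫⁻ x in S, ∏ j, (if j = b' then F (dropCoord a (ψ x) j)
          else G (dropCoord a (ψ x) j)) ∂μH[(n : ℝ)])) := by gcongr
    _ = ∫⁻ x in S, (L : ℝ≥0∞)⁻¹ * ∏ j, (if j = b' then F (dropCoord a (ψ x) j)
          else G (dropCoord a (ψ x) j)) ∂μH[(n : ℝ)] := by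
        rw [← mul_assoc ((L : ℝ≥0∞) ^ (n : ℝ))⁻¹, ENNReal.inv_mul_cancel hLn0 hLn, one_mul]
        exact (lintegral_const_mul _ (hm.comp (h.measurable_dropCoord_comp a))).symm
    _ ≤ _ := setLIntegral_mono' hSm hbound

end AdaptedChart

/-! ### Effective dimension two -/

/-- The coordinate change turning `q b ^ 2 - q a ^ 2` into a product. -/
def lightCone {D : ℕ} (a b : Fin D) (q : Fin D → ℝ) : Fin D → ℝ :=
  fun k => if k = a then q b - q a else if k = b then q b + q a else q k

theorem quadForm_eq_lightCone_mul {D : ℕ} {σ : Fin D → SignType} {a b : Fin D} (hab : b ≠ a)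
    (ha : σ a = -1) (hb : σ b = 1) (hσ : ∀ k, σ k ≠ 0 → k = a ∨ k = b) (q : Fin D → ℝ) :
    quadForm σ q = lightCone a b q a * lightCone a b q b := by
  unfold quadForm
  rw [Finset.sum_eq_add a b hab.symm (fun c _ hc => by
    have : σ c = 0 := by
      by_contra h
      rcases hσ c h with h | h
      exacts [hc.1 h, hc.2 h]
    simp [this]) (by simp) (by simp)]
  simp only [ha, hb, lightCone, if_true, if_neg hab]
  rw [SignType.coe_neg_one, SignType.coe_one]
  ring

namespace AdaptedChart

/-- The change of coordinates expands sup distances by at most `2` and never contracts them, since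
`q a` and `q b` are half the difference and half the sum of the new coordinates; hence the constant
`2 * L`. -/
theorem lightCone {D : ℕ} {E : PhaseSpace D → ℝ} {p : PhaseSpace D} {N : (Fin D → ℝ) → ℝ}
    {ψ : PhaseSpace D → Fin D → ℝ} {r : ℝ} {L : ℝ≥0} {a b : Fin D} (hab : b ≠ a)
    (h : AdaptedChart E p {a, b} N ψ r L)
    (hN : ∀ q, N q = lightCone a b q a * lightCone a b q b) :
    AdaptedChart E p {a, b} (fun q => q a * q b) (fun x => VanHove.lightCone a b (ψ x)) r
      (2 * L) := by
  have hva : ∀ q : Fin D → ℝ, VanHove.lightCone a b q a = q b - q a := fun q => by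
    simp [VanHove.lightCone]
  have hvb : ∀ q : Fin D → ℝ, VanHove.lightCone a b q b = q b + q a := fun q => by
    simp [VanHove.lightCone, hab]
  have hvk : ∀ (q : Fin D → ℝ) k, k ≠ a → k ≠ b → VanHove.lightCone a b q k = q k :=
    fun q k h1 h2 => by simp [VanHove.lightCone, h1, h2]
  have hup : ∀ q q', dist (VanHove.lightCone a b q) (VanHove.lightCone a b q') ≤
      2 * dist q q' := by
    intro q q'
    have h0 : 0 ≤ dist q q' := dist_nonneg
    have h1 := abs_le.1 (dist_le_pi_dist q q' a)
    have h2 := abs_le.1 (dist_le_pi_dist q q' b)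
    refine (dist_pi_le_iff (by positivity)).2 fun k => ?_
    by_cases hka : k = a
    · subst hka
      rw [hva, hva, Real.dist_eq, abs_le]
      constructor <;> linarith
    by_cases hkb : k = b
    · subst hkb
      rw [hvb, hvb, Real.dist_eq, abs_le]
      constructor <;> linarith
    · rw [hvk _ _ hka hkb, hvk _ _ hka hkb]
      exact (dist_le_pi_dist q q' k).trans (by linarith)
  have hdown : ∀ q q', dist q q' ≤
      dist (VanHove.lightCone a b q) (VanHove.lightCone a b q') := by
    intro q q'
    have h1 := abs_le.1
      (dist_le_pi_dist (VanHove.lightCone a b q) (VanHove.lightCone a b q') a)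
    have h2 := abs_le.1
      (dist_le_pi_dist (VanHove.lightCone a b q) (VanHove.lightCone a b q') b)
    rw [hva, hva] at h1
    rw [hvb, hvb] at h2
    refine (dist_pi_le_iff dist_nonneg).2 fun k => ?_
    by_cases hka : k = a
    · subst hka
      rw [Real.dist_eq, abs_le]
      constructor <;> linarith
    by_cases hkb : k = b
    · subst hkb
      rw [Real.dist_eq, abs_le]
      constructor <;> linarith
    · have := dist_le_pi_dist (VanHove.lightCone a b q) (VanHove.lightCone a b q') k
      rwa [hvk _ _ hka hkb, hvk _ _ hka hkb] at this
  have hzero : VanHove.lightCone a b (0 : Fin D → ℝ) = 0 := by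
    ext k; simp [VanHove.lightCone]
  refine ⟨h.r_pos, mul_pos two_pos h.L_pos, ?_, ?_, ?_, ?_, h.diff, fun x hx => ?_, ?_, ?_⟩
  · exact (LipschitzWith.of_dist_le_mul (K := 2) fun q q' => by simpa using hup q q').comp h.lip
  · intro x hx y hy
    refine (h.antilip x hx y hy).trans ?_
    have h1 := hdown (ψ x) (ψ y)
    have h2 : (0 : ℝ) ≤ L := L.coe_nonneg
    have h3 : dist (ψ x) (ψ y) ≥ 0 := dist_nonneg
    push_cast
    nlinarith [mul_le_mul_of_nonneg_left h1 h2, mul_nonneg h2 (h3.le.trans h1)]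
  · simp only [h.map_base, hzero]
  · intro ρ hρ
    obtain ⟨s, hs, hsurj⟩ := h.surj ρ hρ
    refine ⟨s, hs, fun q hq => ?_⟩
    set q' : Fin D → ℝ := fun k => if k = a then (q b - q a) / 2 else
      if k = b then (q b + q a) / 2 else q k with hq'
    have hqq : VanHove.lightCone a b q' = q := by
      ext k
      by_cases hka : k = a
      · subst hka
        rw [hva]
        simp only [hq', if_true, if_neg hab]
        ring
      by_cases hkb : k = b
      · subst hkb
        rw [hvb]
        simp only [hq', if_true, if_neg hab]
        ring
      · rw [hvk _ _ hka hkb]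
        simp only [hq', if_neg hka, if_neg hkb]
    have hnorm : ‖q'‖ < s := by
      have := hdown q' 0
      rw [hzero, hqq, dist_zero_right, dist_zero_right] at this
      exact this.trans_lt hq
    obtain ⟨x, hx, hxq⟩ := hsurj q' hnorm
    exact ⟨x, hx, by rw [hxq, hqq]⟩
  · simp only [h.eq x hx, hN]
  · intro x hx M hM hk
    have h1 := abs_le.1 (hk a (by simp))
    have h2 := abs_le.1 (hk b (by simp))
    rw [hva] at h1
    rw [hvb] at h2
    refine (h.grad_le x hx M hM fun k hkA => ?_).trans ?_
    · rcases Finset.mem_insert.1 hkA with rfl | hkA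
      · exact abs_le.2 ⟨by linarith, by linarith⟩
      · rw [Finset.mem_singleton.1 hkA]
        exact abs_le.2 ⟨by linarith, by linarith⟩
    · push_cast
      nlinarith [mul_nonneg L.coe_nonneg hM]
  · intro x hx k hk
    have h1 := h.le_grad x hx a (by simp)
    have h2 := h.le_grad x hx b (by simp)
    push_cast
    rcases Finset.mem_insert.1 hk with rfl | hk
    · rw [hva]
      exact (abs_sub _ _).trans (by linarith)
    · rw [Finset.mem_singleton.1 hk, hvb]
      exact (abs_add_le _ _).trans (by linarith)

variable {n : ℕ} {E : PhaseSpace (n + 1) → ℝ} {p : PhaseSpace (n + 1)}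
  {ψ : PhaseSpace (n + 1) → Fin (n + 1) → ℝ} {r : ℝ} {L : ℝ≥0}

theorem logDivergent_phaseMeasure {a b : Fin (n + 1)} (hab : b ≠ a)
    (h : AdaptedChart E p {a, b} (fun q => q a * q b) ψ r L) :
    ∀ᶠ η in 𝓝[>] (0 : ℝ), LogDivergent fun ε =>
      phaseMeasure E {x ∈ Metric.ball p η | ε < Metric.infDist x (criticalSet E)} := by
  obtain ⟨η₀, hη₀, hη₀r, hdist⟩ := h.exists_infDist_bounds fun q hq => by
    simp [hq a (by simp)]
  have hL : (0 : ℝ) < L := by exact_mod_cast h.L_pos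
  have hr := h.r_pos
  obtain ⟨K₁, hK₁, hup₁⟩ := h.setLIntegral_inv_gradient_le hab (by simp)
  obtain ⟨K₂, hK₂, hup₂⟩ := h.setLIntegral_inv_gradient_le hab.symm (by simp)
  filter_upwards [Ioc_mem_nhdsGT hη₀] with η hη
  have hηr : η ≤ r := hη.2.trans hη₀r
  obtain ⟨K, hK, R, hR, hlow⟩ := h.le_setLIntegral_inv_gradient hab subset_rfl hη.1 hηr
  have hSm : ∀ ε, MeasurableSet
      {x ∈ Metric.ball p η | ε < Metric.infDist x (criticalSet E)} := fun ε =>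
    Metric.isOpen_ball.measurableSet.inter
      (measurableSet_lt measurable_const (Metric.continuous_infDist_pt _).measurable)
  -- From below, one hyperplane cut at `|q b| ≥ 2 L ε` suffices: there the distance is at least `2
  -- ε`, hence strictly above `ε`. From above, distance `> ε` forces the nonzero coordinate to be at
  -- least `ε / L` on either hyperplane.
  refine LogDivergent.of_le_of_le (K₁ := K) (K₂ := K₁ + K₂) (a₁ := R / (2 * L))
    (a₂ := L * r * L) hK (ENNReal.add_ne_top.2 ⟨hK₁, hK₂⟩) (by positivity) (by positivity) ?_ ?_
  · filter_upwards [Ioc_mem_nhdsGT (show 0 < R / (2 * L) by positivity)] with ε hε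
    have h1 := hlow (2 * L * ε) (mul_pos (by positivity) hε.1) (by
      have := hε.2
      rwa [le_div_iff₀' (by positivity)] at this)
    rw [div_div]
    refine h1.trans ?_
    rw [phaseMeasure_apply E (hSm ε)]
    refine lintegral_mono_set ?_
    rintro x ⟨hx, hxa, hxb⟩
    refine ⟨⟨hx, ?_⟩, ?_⟩
    · have := (hdist x (Metric.ball_subset_ball hη.2 hx)).1 b (by simp)
      have h2 : L * (2 * ε) ≤ L * Metric.infDist x (criticalSet E) := by
        rw [← mul_assoc, mul_comm (L : ℝ)]; exact hxb.trans this
      have := le_of_mul_le_mul_left h2 hL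
      linarith [hε.1]
    · rw [Set.mem_ofPred_eq, h.eq x (Metric.ball_subset_ball hηr hx), hxa, zero_mul]
  · filter_upwards [Ioc_mem_nhdsGT (show 0 < L * r * L by positivity)] with ε hε
    have hεL : 0 < ε / L := div_pos hε.1 hL
    have hεL' : ε / L ≤ L * r := (div_le_iff₀ hL).2 hε.2
    have h1 := hup₁ (ε / L) hεL hεL'
    have h2 := hup₂ (ε / L) hεL hεL'
    have heq : L * r / (ε / L) = L * r * L / ε := by
      field_simp
    rw [heq] at h1 h2
    rw [phaseMeasure_apply E (hSm ε), add_mul]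
    refine le_trans (le_trans (lintegral_mono_set ?_) (lintegral_union_le _ _ _)) (add_le_add h1 h2)
    rintro x ⟨⟨hx, hxε⟩, hx0⟩
    have hxr := Metric.ball_subset_ball hηr hx
    rw [Set.mem_ofPred_eq, h.eq x hxr] at hx0
    have hd := (hdist x (Metric.ball_subset_ball hη.2 hx)).2
    rcases mul_eq_zero.1 hx0 with h0 | h0
    · refine Or.inl ⟨hxr, h0, ?_⟩
      rw [div_le_iff₀' hL]
      refine hxε.le.trans (hd _ (fun k hk => ?_) (abs_nonneg _))
      rcases Finset.mem_insert.1 hk with rfl | hk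
      · rw [h0, abs_zero]; exact abs_nonneg _
      · rw [Finset.mem_singleton.1 hk]
    · refine Or.inr ⟨hxr, h0, ?_⟩
      rw [div_le_iff₀' hL]
      refine hxε.le.trans (hd _ (fun k hk => ?_) (abs_nonneg _))
      rcases Finset.mem_insert.1 hk with rfl | hk
      · exact le_rfl
      · rw [Finset.mem_singleton.1 hk, h0, abs_zero]; exact abs_nonneg _

end AdaptedChart

/-! ### The broadened delta function -/

theorem lintegral_lorentzian_box_le {n : ℕ} {a : Fin (n + 1)} {b : Fin n} {R : ℝ} (hR : 0 < R) :
    ∃ K : ℝ≥0∞, K ≠ ∞ ∧ ∀ γ : ℝ, 0 < γ → γ ≤ R →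
      ∫⁻ q in {q : Fin (n + 1) → ℝ | ∀ k, q k ∈ Set.Icc (-R) R},
        ENNReal.ofReal (lorentzian γ (q a * q (a.succAbove b))) ≤
          K * ENNReal.ofReal (Real.log (R * Real.exp (2 * R) / γ)) := by
  refine ⟨2 * ENNReal.ofReal (2 * R) ^ (n - 1),
    (ENNReal.mul_lt_top (by simp) (ENNReal.pow_lt_top ENNReal.ofReal_lt_top)).ne,
    fun γ hγ hγR => ?_⟩
  have hBm := measurableSet_box (n := n + 1) R
  have hlm := measurable_lorentzian γ
  have hm : Measurable fun q : Fin (n + 1) → ℝ =>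
      ENNReal.ofReal (lorentzian γ (q a * q (a.succAbove b))) := by fun_prop
  have hmeas : MeasurableSet {t : ℝ | γ ≤ |t| ∧ |t| ≤ R} :=
    measurableSet_Icc.preimage (f := fun t : ℝ => |t|) (by fun_prop)
  -- Bound for the slice at `v = t`: for `|t| ≥ γ` the full-line integral `1 / |t|`, and for small
  -- `|t|` the maximum `1 / γ` times the length `2 R`.
  set F : ℝ → ℝ≥0∞ := fun t => (Set.Icc (-γ) γ).indicator (fun _ => ENNReal.ofReal (2 * R / γ)) t +
    {t : ℝ | γ ≤ |t| ∧ |t| ≤ R}.indicator (fun t => ENNReal.ofReal |t|⁻¹) t with hF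
  set G : ℝ → ℝ≥0∞ := (Set.Icc (-R) R).indicator 1 with hG
  have hFm : Measurable F := (Measurable.indicator measurable_const measurableSet_Icc).add
    (Measurable.indicator (by fun_prop) hmeas)
  have hGm : Measurable G := Measurable.indicator measurable_const measurableSet_Icc
  have hslice : ∀ v : ℝ, |v| ≤ R →
      ∫⁻ u in Set.Icc (-R) R, ENNReal.ofReal (lorentzian γ (u * v)) ≤ F v := by
    intro v hv
    rcases le_or_gt γ |v| with h | h
    · have hv0 : v ≠ 0 := abs_pos.1 (hγ.trans_le h)
      refine (setLIntegral_le_lintegral _ _).trans ((lintegral_lorentzian_mul hγ hv0).le.trans ?_)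
      rw [hF]
      refine le_add_left ?_
      rw [Set.indicator_of_mem (show v ∈ {t : ℝ | γ ≤ |t| ∧ |t| ≤ R} from ⟨h, hv⟩)]
    · rw [hF]
      refine le_add_right ?_
      rw [Set.indicator_of_mem (show v ∈ Set.Icc (-γ) γ from Set.mem_Icc.2 (abs_le.1 h.le))]
      calc ∫⁻ u in Set.Icc (-R) R, ENNReal.ofReal (lorentzian γ (u * v))
          ≤ ∫⁻ _ in Set.Icc (-R) R, ENNReal.ofReal γ⁻¹ := by
            gcongr with u
            exact lorentzian_le hγ _
        _ = ENNReal.ofReal (2 * R / γ) := by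
            rw [setLIntegral_const, Real.volume_Icc, ← ENNReal.ofReal_mul (by positivity)]
            congr 1
            ring
  have hpt : ∀ q' : Fin n → ℝ, ∫⁻ u : ℝ, {q : Fin (n + 1) → ℝ | ∀ k, q k ∈ Set.Icc (-R) R}.indicator
      (fun q => ENNReal.ofReal (lorentzian γ (q a * q (a.succAbove b)))) (a.insertNth u q') ≤
        ∏ j, (if j = b then F (q' j) else G (q' j)) := by
    intro q'
    by_cases hq' : ∀ j, q' j ∈ Set.Icc (-R) R
    · rw [Finset.prod_eq_single b (fun j _ hj => by
        rw [if_neg hj, hG, Set.indicator_of_mem (hq' j)]; rfl) (by simp), if_pos rfl]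
      refine le_trans ?_ (hslice (q' b) (abs_le.2 (hq' b)))
      rw [← lintegral_indicator measurableSet_Icc]
      refine lintegral_mono fun u => ?_
      refine Set.indicator_apply_le' (fun hmem => ?_) fun _ => zero_le
      have hu : u ∈ Set.Icc (-R) R := by simpa using hmem a
      rw [Set.indicator_of_mem hu]
      simp
    · have : ∀ u : ℝ, {q : Fin (n + 1) → ℝ | ∀ k, q k ∈ Set.Icc (-R) R}.indicator
          (fun q => ENNReal.ofReal (lorentzian γ (q a * q (a.succAbove b))))
            (a.insertNth u q') = 0 := fun u => by
        refine Set.indicator_of_notMem (fun hmem => hq' fun j => ?_) _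
        simpa using hmem (a.succAbove j)
      simp only [this, lintegral_zero, zero_le]
  -- The central part contributes `4 R` and the outer part `2 log (R / γ)`; the factor `exp (2 R)`
  -- packs the constant into the logarithm.
  have hFint : ∫⁻ t, F t ≤ 2 * ENNReal.ofReal (Real.log (R * Real.exp (2 * R) / γ)) := by
    have hlog : 0 ≤ Real.log (R / γ) := Real.log_nonneg ((one_le_div hγ).2 hγR)
    have hlog' : Real.log (R * Real.exp (2 * R) / γ) = 2 * R + Real.log (R / γ) := by
      rw [mul_div_right_comm, Real.log_mul (by positivity) (Real.exp_ne_zero _), Real.log_exp]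
      ring
    rw [hF, lintegral_add_left (Measurable.indicator measurable_const measurableSet_Icc),
      lintegral_indicator measurableSet_Icc, lintegral_indicator hmeas, setLIntegral_const,
      Real.volume_Icc, ← ENNReal.ofReal_mul (by positivity)]
    refine (add_le_add le_rfl (lintegral_abs_inv_le hγ hγR)).trans ?_
    rw [← ENNReal.ofReal_add (by
      rw [sub_neg_eq_add]; positivity) (by positivity), ← ENNReal.ofReal_ofNat,
      ← ENNReal.ofReal_mul (by norm_num), hlog']
    refine ENNReal.ofReal_le_ofReal (le_of_eq ?_)
    field_simp
    ring
  rw [← lintegral_indicator hBm, lintegral_fin_eq_insertNth a (hm.indicator hBm)]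
  refine (lintegral_mono hpt).trans ?_
  rw [lintegral_fin_prod_single b hFm hGm, hG, lintegral_indicator_one measurableSet_Icc,
    Real.volume_Icc, sub_neg_eq_add, ← two_mul]
  calc _ ≤ 2 * ENNReal.ofReal (Real.log (R * Real.exp (2 * R) / γ)) *
        ENNReal.ofReal (2 * R) ^ (n - 1) := by gcongr
    _ = _ := by ring

theorem le_lintegral_lorentzian_box {n : ℕ} {a : Fin (n + 1)} {b : Fin n} {R : ℝ} (hR : 0 < R) :
    ∃ K : ℝ≥0∞, K ≠ 0 ∧ ∀ γ : ℝ, 0 < γ → γ ≤ R ^ 2 →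
      K * ENNReal.ofReal (Real.log (R ^ 2 / γ)) ≤
        ∫⁻ q in {q : Fin (n + 1) → ℝ | ∀ k, q k ∈ Set.Icc (-R) R},
          ENNReal.ofReal (lorentzian γ (q a * q (a.succAbove b))) := by
  refine ⟨ENNReal.ofReal (2 * Real.pi)⁻¹ * ENNReal.ofReal (2 * R) ^ (n - 1), mul_ne_zero ?_
    (pow_ne_zero _ ?_), fun γ hγ hγR => ?_⟩
  · rw [Ne, ENNReal.ofReal_eq_zero, not_le]
    have := Real.pi_pos
    positivity
  · rw [Ne, ENNReal.ofReal_eq_zero, not_le]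
    positivity
  have hBm := measurableSet_box (n := n + 1) R
  have hlm := measurable_lorentzian γ
  have hm : Measurable fun q : Fin (n + 1) → ℝ =>
      ENNReal.ofReal (lorentzian γ (q a * q (a.succAbove b))) := by fun_prop
  set F : ℝ → ℝ≥0∞ := (Set.Icc (γ / R) R).indicator
    (fun t => ENNReal.ofReal (2 * Real.pi)⁻¹ * ENNReal.ofReal t⁻¹) with hF
  set G : ℝ → ℝ≥0∞ := (Set.Icc (-R) R).indicator 1 with hG
  have hFm : Measurable F := Measurable.indicator (by fun_prop) measurableSet_Icc
  have hGm : Measurable G := Measurable.indicator measurable_const measurableSet_Icc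
  have hγR0 : 0 < γ / R := by positivity
  have hγR' : γ / R ≤ R := by rw [div_le_iff₀ hR, ← sq]; exact hγR
  have hslice : ∀ v ∈ Set.Icc (γ / R) R, ENNReal.ofReal (2 * Real.pi)⁻¹ * ENNReal.ofReal v⁻¹ ≤
      ∫⁻ u in Set.Icc (-R) R, ENNReal.ofReal (lorentzian γ (u * v)) := by
    intro v hv
    have hv0 : 0 < v := hγR0.trans_le hv.1
    -- On `0 ≤ u ≤ γ / v` the product `u v` stays below `γ`, so the Lorentzian is at least `1 / (2 π
    -- γ)`; `v ≥ γ / R` keeps this interval inside the box.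
    have hsub : Set.Icc 0 (γ / v) ⊆ Set.Icc (-R) R := fun u hu => by
      refine ⟨by linarith [hu.1], hu.2.trans ?_⟩
      rw [div_le_iff₀ hv0, ← div_le_iff₀' hR]
      exact hv.1
    calc ENNReal.ofReal (2 * Real.pi)⁻¹ * ENNReal.ofReal v⁻¹
        = ∫⁻ _ in Set.Icc 0 (γ / v), ENNReal.ofReal (2 * Real.pi * γ)⁻¹ := by
          have := Real.pi_pos
          rw [setLIntegral_const, Real.volume_Icc, ← ENNReal.ofReal_mul (by positivity),
            ← ENNReal.ofReal_mul (by positivity)]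
          congr 1
          field_simp
          ring
      _ ≤ ∫⁻ u in Set.Icc 0 (γ / v), ENNReal.ofReal (lorentzian γ (u * v)) := by
          refine setLIntegral_mono' measurableSet_Icc fun u hu => ENNReal.ofReal_le_ofReal ?_
          refine le_lorentzian hγ ?_
          rw [abs_of_nonneg (mul_nonneg hu.1 hv0.le)]
          exact (le_div_iff₀ hv0).1 hu.2
      _ ≤ _ := lintegral_mono_set hsub
  have hpt : ∀ q' : Fin n → ℝ, ∏ j, (if j = b then F (q' j) else G (q' j)) ≤
      ∫⁻ u : ℝ, {q : Fin (n + 1) → ℝ | ∀ k, q k ∈ Set.Icc (-R) R}.indicator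
        (fun q => ENNReal.ofReal (lorentzian γ (q a * q (a.succAbove b)))) (a.insertNth u q') := by
    intro q'
    by_cases hq' : q' b ∈ Set.Icc (γ / R) R ∧ ∀ j, q' j ∈ Set.Icc (-R) R
    · rw [Finset.prod_eq_single b (fun j _ hj => by
        rw [if_neg hj, hG, Set.indicator_of_mem (hq'.2 j)]; rfl) (by simp), if_pos rfl, hF,
        Set.indicator_of_mem hq'.1]
      refine (hslice (q' b) hq'.1).trans ?_
      rw [← lintegral_indicator measurableSet_Icc]
      refine lintegral_mono fun u => ?_
      refine Set.indicator_apply_le' (fun hu => ?_) fun _ => zero_le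
      rw [Set.indicator_of_mem (show a.insertNth u q' ∈
        {q : Fin (n + 1) → ℝ | ∀ k, q k ∈ Set.Icc (-R) R} from fun k => ?_)]
      · simp
      · rcases eq_or_ne k a with rfl | hk
        · simpa using hu
        · obtain ⟨j, rfl⟩ := Fin.exists_succAbove_eq hk
          rw [Fin.insertNth_apply_succAbove]
          exact hq'.2 j
    · refine le_of_eq_of_le (Finset.prod_eq_zero_iff.2 ?_) zero_le
      by_contra! hne
      have hb : q' b ∈ Set.Icc (γ / R) R := by
        have := hne b (Finset.mem_univ _)
        rw [if_pos rfl] at this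
        exact Set.mem_of_indicator_ne_zero this
      refine hq' ⟨hb, fun j => ?_⟩
      have := hne j (Finset.mem_univ _)
      split_ifs at this with hj
      · subst hj
        exact ⟨by linarith [hb.1], hb.2⟩
      · exact Set.mem_of_indicator_ne_zero this
  rw [← lintegral_indicator hBm, lintegral_fin_eq_insertNth a (hm.indicator hBm)]
  refine le_of_eq_of_le ?_ (lintegral_mono hpt)
  have hdiv : R / (γ / R) = R ^ 2 / γ := by field_simp
  rw [lintegral_fin_prod_single b hFm hGm, hG, lintegral_indicator_one measurableSet_Icc,
    Real.volume_Icc, sub_neg_eq_add, ← two_mul, hF, lintegral_indicator measurableSet_Icc,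
    lintegral_const_mul _ (by fun_prop), lintegral_Icc_inv hγR0 hγR', hdiv]
  ring

theorem AdaptedChart.logDivergent_lorentzian {n : ℕ} {E : PhaseSpace (n + 1) → ℝ}
    {p : PhaseSpace (n + 1)} {ψ : PhaseSpace (n + 1) → Fin (n + 1) → ℝ} {r : ℝ} {L : ℝ≥0}
    {a b : Fin (n + 1)} (hab : b ≠ a)
    (h : AdaptedChart E p {a, b} (fun q => q a * q b) ψ r L) :
    ∀ᶠ η in 𝓝[>] (0 : ℝ), LogDivergent fun γ =>
      ∫⁻ x in Metric.ball p η, ENNReal.ofReal (lorentzian γ (E x)) := by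
  obtain ⟨b', rfl⟩ := Fin.exists_succAbove_eq hab
  have hL : (0 : ℝ) < L := by exact_mod_cast h.L_pos
  have hr := h.r_pos
  obtain ⟨C₁, hC₁, hup⟩ := h.setLIntegral_comp_le
  obtain ⟨C₂, hC₂, hlow⟩ := h.le_setLIntegral_comp
  set R : ℝ := L * r with hR
  have hRpos : 0 < R := by positivity
  obtain ⟨K₁, hK₁, hbox₁⟩ := lintegral_lorentzian_box_le (a := a) (b := b') hRpos
  filter_upwards [Ioc_mem_nhdsGT hr] with η hη
  obtain ⟨s, hs, hsurj⟩ := h.surj η hη.1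
  obtain ⟨K₂, hK₂, hbox₂⟩ := le_lintegral_lorentzian_box (a := a) (b := b') (half_pos hs)
  have hsub : Metric.ball p η ⊆ Metric.ball p r := Metric.ball_subset_ball hη.2
  have hball : MeasurableSet (Metric.ball p η) := Metric.isOpen_ball.measurableSet
  have hEψ : ∀ γ, ∫⁻ x in Metric.ball p η, ENNReal.ofReal (lorentzian γ (E x)) =
      ∫⁻ x in Metric.ball p η, ENNReal.ofReal (lorentzian γ (ψ x a * ψ x (a.succAbove b'))) :=
    fun γ => setLIntegral_congr_fun hball fun x hx => by simp only [h.eq x (hsub hx)]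
  have hm : ∀ γ, Measurable fun q : Fin (n + 1) → ℝ =>
      ENNReal.ofReal (lorentzian γ (q a * q (a.succAbove b'))) := fun γ => by
    have := measurable_lorentzian γ
    fun_prop
  have hBm := measurableSet_box (n := n + 1) R
  -- The `1` added to `C₂` makes the inverted constant nonzero as well as finite.
  refine LogDivergent.of_le_of_le (K₁ := (C₂ + 1)⁻¹ * K₂) (K₂ := C₁ * K₁) (a₁ := (s / 2) ^ 2)
    (a₂ := R * Real.exp (2 * R)) (mul_ne_zero (ENNReal.inv_ne_zero.2 (by simp [hC₂])) hK₂)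
    (ENNReal.mul_ne_top hC₁ hK₁) (by positivity) (by positivity) ?_ ?_
  · filter_upwards [Ioc_mem_nhdsGT (show 0 < (s / 2) ^ 2 by positivity)] with γ hγ
    have h1 := hlow _ hball {q | ∀ k, q k ∈ Set.Icc (-(s / 2)) (s / 2)} (fun q hq => by
      obtain ⟨x, hx, hxq⟩ := hsurj q ((pi_norm_lt_iff hs).2 fun k =>
        (abs_le.2 (hq k)).trans_lt (by linarith))
      exact ⟨x, hx, hxq⟩) _ (hm γ)
    have h2 := (hbox₂ γ hγ.1 hγ.2).trans h1
    rw [hEψ, mul_assoc]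
    rw [ENNReal.inv_mul_le_iff (by simp) (by simp [hC₂])]
    refine h2.trans ?_
    gcongr
    exact le_self_add
  · filter_upwards [Ioc_mem_nhdsGT hRpos] with γ hγ
    have h1 := hup _ hsub hball _ ((hm γ).indicator hBm)
    rw [lintegral_indicator hBm] at h1
    rw [hEψ, mul_assoc]
    refine le_trans (le_of_eq (setLIntegral_congr_fun hball fun x hx => ?_))
      (h1.trans (by gcongr; exact hbox₁ γ hγ.1 hγ.2))
    rw [Set.indicator_of_mem]
    refine fun k => Set.mem_Icc.2 (abs_le.1 ((h.abs_apply_le x k).trans ?_))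
    rw [hR]
    gcongr
    exact (Metric.mem_ball.1 (hsub hx)).le

/-! ### The dichotomy near a point with a normal form chart -/

theorem signCount_neg_add_signCount_pos {D : ℕ} (σ : Fin D → SignType) :
    signCount σ (-1) + signCount σ 1 = (Finset.univ.filter fun i => σ i ≠ 0).card := by
  unfold signCount
  rw [← Finset.card_union_of_disjoint, ← Finset.filter_or]
  · congr 1
    ext i
    rcases h : σ i <;> simp [h]
  · refine Finset.disjoint_filter.2 fun i _ h h' => ?_
    rw [h] at h'
    exact absurd h' (by decide)

theorem card_ne_zero_add_signCount_zero {D : ℕ} (σ : Fin D → SignType) :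
    (Finset.univ.filter fun i => σ i ≠ 0).card + signCount σ 0 = D := by
  unfold signCount
  have := Finset.card_filter_add_card_filter_not (s := Finset.univ) fun i => σ i = 0
  simp only [Finset.card_univ, Fintype.card_fin] at this
  simp only [ne_eq]
  omega

theorem eq_zero_of_quadForm_eq_zero {D : ℕ} {σ : Fin D → SignType}
    (hσ : signCount σ (-1) = 0 ∨ signCount σ 1 = 0) {q : Fin D → ℝ} (hq : quadForm σ q = 0)
    {i : Fin D} (hi : σ i ≠ 0) : q i = 0 := by
  have key : (σ i : ℝ) * q i ^ 2 = 0 := by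
    unfold quadForm at hq
    rcases hσ with h | h
    · have h' : ∀ j, σ j ≠ -1 := by simpa [signCount, Finset.filter_eq_empty_iff] using h
      refine (Finset.sum_eq_zero_iff_of_nonneg fun j _ => ?_).1 hq i (Finset.mem_univ _)
      have : (0 : ℝ) ≤ σ j := by
        have := h' j
        rcases h : σ j <;> simp_all
      positivity
    · have h' : ∀ j, σ j ≠ 1 := by simpa [signCount, Finset.filter_eq_empty_iff] using h
      refine (Finset.sum_eq_zero_iff_of_nonpos fun j _ => ?_).1 hq i (Finset.mem_univ _)
      have : (σ j : ℝ) ≤ 0 := by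
        have := h' j
        rcases h : σ j <;> simp_all
      exact mul_nonpos_of_nonpos_of_nonneg this (sq_nonneg _)
  rcases mul_eq_zero.1 key with h | h
  · rcases h' : σ i <;> simp_all
  · exact pow_eq_zero_iff two_ne_zero |>.1 h

theorem exists_lightCone_chart {n : ℕ} {E : PhaseSpace (n + 1) → ℝ} {p : PhaseSpace (n + 1)}
    {σ : Fin (n + 1) → SignType} {ψ : PhaseSpace (n + 1) → Fin (n + 1) → ℝ} {r : ℝ} {L : ℝ≥0}
    (h : AdaptedChart E p (Finset.univ.filter fun i => σ i ≠ 0) (quadForm σ) ψ r L)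
    (hcard : (Finset.univ.filter fun i => σ i ≠ 0).card = 2) (hm : signCount σ (-1) ≠ 0)
    (hn : signCount σ 1 ≠ 0) :
    ∃ a b : Fin (n + 1), b ≠ a ∧ ∃ ψ' L',
      AdaptedChart E p {a, b} (fun q => q a * q b) ψ' r L' := by
  obtain ⟨a, ha⟩ := Finset.card_ne_zero.1 hm
  obtain ⟨b, hb⟩ := Finset.card_ne_zero.1 hn
  simp only [Finset.mem_filter, Finset.mem_univ, true_and] at ha hb
  have hab : b ≠ a := by
    rintro rfl
    rw [ha] at hb
    exact absurd hb (by decide)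
  have hA : ({a, b} : Finset (Fin (n + 1))) = Finset.univ.filter fun i => σ i ≠ 0 := by
    refine Finset.eq_of_subset_of_card_le ?_ (by rw [hcard, Finset.card_pair hab.symm])
    intro k hk
    rcases Finset.mem_insert.1 hk with rfl | hk
    · simp [ha]
    · rw [Finset.mem_singleton.1 hk]
      simp [hb]
  rw [← hA] at h
  refine ⟨a, b, hab, _, _, h.lightCone hab (quadForm_eq_lightCone_mul hab ha hb fun k hk => ?_)⟩
  have : k ∈ ({a, b} : Finset (Fin (n + 1))) := by rw [hA]; simpa using hk
  simpa using this

theorem IsNormalFormChart.dichotomy {D : ℕ} (hD : 1 ≤ D) {E : PhaseSpace D → ℝ} {p : PhaseSpace D}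
    (hp : E p = 0) {σ : Fin D → SignType}
    {φ : OpenPartialHomeomorph (PhaseSpace D) (PhaseSpace D)} (hφ : IsNormalFormChart 1 E p σ φ)
    {d : ℕ} (hd : d + signCount σ 0 = D) :
    Dichotomy E p d (signCount σ (-1)) (signCount σ 1) := by
  obtain ⟨n, rfl⟩ : ∃ n, D = n + 1 := ⟨D - 1, by omega⟩
  have hcard : (Finset.univ.filter fun i => σ i ≠ 0).card = d := by
    have := card_ne_zero_add_signCount_zero σ
    omega
  obtain ⟨ψ, r, L, h⟩ := hφ.exists_adaptedChart hp
  have hnhds : Metric.ball p r ∈ 𝓝 p := Metric.ball_mem_nhds p h.r_pos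
  have hlog : d = 2 → signCount σ (-1) ≠ 0 → signCount σ 1 ≠ 0 → ∀ᶠ η in 𝓝[>] (0 : ℝ),
      LogDivergent fun ε =>
        phaseMeasure E {x ∈ Metric.ball p η | ε < Metric.infDist x (criticalSet E)} := by
    intro hd hm hn
    obtain ⟨a, b, hab, ψ', L', h'⟩ := exists_lightCone_chart h (hcard.trans hd) hm hn
    exact h'.logDivergent_phaseMeasure hab
  refine ⟨fun hd => ⟨_, hnhds, h.phaseMeasure_ball_lt_top (hd.trans_eq hcard.symm)⟩,
    fun hd hmn U hU => ?_, fun hd hmn => ⟨_, hnhds, ?_⟩, hlog, fun hd hm hn => ?_⟩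
  · rcases hd.lt_or_eq with hd | hd
    -- This includes `d = 0`, where `E` vanishes near `p` and any coordinate serves as `i`.
    · obtain ⟨i, hi⟩ := Finset.card_le_one_iff_subset_singleton.1 (by omega :
        (Finset.univ.filter fun i => σ i ≠ 0).card ≤ 1)
      refine h.phaseMeasure_eq_top hi (fun q hq => Finset.sum_eq_zero fun k _ => ?_) hU
      by_cases hk : σ k = 0
      · simp [hk]
      · rw [Finset.mem_singleton.1 (hi (by simpa using hk : k ∈ _)), hq]
        simp
    · obtain ⟨hm, hn⟩ := hmn hd
      obtain ⟨ρ, hρ, hρU⟩ := Metric.mem_nhds_iff.1 hU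
      obtain ⟨η, hη, hηρ⟩ := ((hlog hd hm hn).and (Ioc_mem_nhdsGT hρ)).exists
      -- The phase measure of `U` bounds every cut-off measure, and these diverge.
      refine hη.tendsto_top (Eventually.of_forall fun ε => measure_mono fun x hx => ?_)
      exact hρU (Metric.ball_subset_ball hηρ.2 hx.1)
  · obtain ⟨i, hi, j, hj, hij⟩ := Finset.one_lt_card.1 (by omega :
      1 < (Finset.univ.filter fun i => σ i ≠ 0).card)
    simp only [Finset.mem_filter, Finset.mem_univ, true_and] at hi hj
    exact h.phaseMeasure_ball_eq_zero hij.symm fun q hq =>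
      ⟨eq_zero_of_quadForm_eq_zero hmn hq hi, eq_zero_of_quadForm_eq_zero hmn hq hj⟩
  · obtain ⟨a, b, hab, ψ', L', h'⟩ := exists_lightCone_chart h (hcard.trans hd) hm hn
    exact h'.logDivergent_lorentzian hab

theorem IsNormalFormChart.of_le {D k l : ℕ} (hkl : l ≤ k) {E : PhaseSpace D → ℝ}
    {p : PhaseSpace D} {σ : Fin D → SignType}
    {φ : OpenPartialHomeomorph (PhaseSpace D) (PhaseSpace D)} (h : IsNormalFormChart k E p σ φ) :
    IsNormalFormChart l E p σ φ :=
  ⟨h.mem_source, h.map_zero, h.contDiffOn.of_le (by exact_mod_cast hkl),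
    h.contDiffOn_symm.of_le (by exact_mod_cast hkl), h.eq_normalForm⟩

/-! ### Hadamard's lemma -/

section Hadamard

variable {V : Type} [NormedAddCommGroup V] [NormedSpace ℝ V]

/-- A weighted average of `h` along the segment from `0` to `x`. -/
noncomputable def radialIntegral {W : Type} [NormedAddCommGroup W] [NormedSpace ℝ W] (j : ℕ) (h : V → W)
    (x : V) : W := ∫ t in (0 : ℝ)..1, t ^ j • h (t • x)

variable {W : Type} [NormedAddCommGroup W] [NormedSpace ℝ W]

theorem continuous_radialIntegral (j : ℕ) {h : V → W} (hh : Continuous h) :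
    Continuous (radialIntegral j h) :=
  intervalIntegral.continuous_parametric_intervalIntegral_of_continuous
    (f := fun x t => t ^ j • h (t • x)) (by unfold Function.uncurry; fun_prop) continuous_const

/-- Differentiating `h (t • x)` in `x` produces one more factor `t`; the weights `t ^ j` make the
class of radial integrals closed under differentiation. -/
theorem hasFDerivAt_radialIntegral [ProperSpace V] (j : ℕ) {h : V → W} (hh : ContDiff ℝ 1 h) (x : V) :
    HasFDerivAt (radialIntegral j h) (radialIntegral (j + 1) (fderiv ℝ h) x) x := by
  have hc : Continuous (fderiv ℝ h) := hh.continuous_fderiv one_ne_zero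
  have hc0 : Continuous h := hh.continuous
  obtain ⟨C, hC⟩ := (isCompact_closedBall (0 : V) (‖x‖ + 1)).exists_bound_of_continuousOn
    hc.continuousOn
  have hI : ∀ t ∈ Set.uIoc (0 : ℝ) 1, 0 ≤ t ∧ t ≤ 1 := fun t ht => by
    rw [Set.uIoc_of_le zero_le_one] at ht
    exact ⟨ht.1.le, ht.2⟩
  refine intervalIntegral.hasFDerivAt_integral_of_dominated_of_fderiv_le
    (F := fun x t => t ^ j • h (t • x)) (F' := fun x t => t ^ (j + 1) • fderiv ℝ h (t • x))
    (s := Metric.ball x 1) (bound := fun _ => C) (Metric.ball_mem_nhds x one_pos)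
    (Eventually.of_forall fun y => ?_) ?_ ?_ ?_ (by simp) ?_
  · exact (show Continuous fun t : ℝ => t ^ j • h (t • y) by fun_prop).aestronglyMeasurable
  · exact (show Continuous fun t : ℝ => t ^ j • h (t • x) by fun_prop).intervalIntegrable _ _
  · exact (show Continuous fun t : ℝ => t ^ (j + 1) • fderiv ℝ h (t • x) by
      fun_prop).aestronglyMeasurable
  · refine ae_of_all _ fun t ht y hy => ?_
    obtain ⟨h0, h1⟩ := hI t ht
    rw [norm_smul, norm_pow, Real.norm_of_nonneg h0]
    have hy' : ‖y‖ ≤ ‖x‖ + 1 := by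
      have := norm_sub_norm_le y x
      have := (mem_ball_iff_norm.1 hy).le
      linarith
    have hmem : t • y ∈ Metric.closedBall (0 : V) (‖x‖ + 1) := by
      rw [mem_closedBall_zero_iff, norm_smul, Real.norm_of_nonneg h0]
      exact (mul_le_of_le_one_left (norm_nonneg _) h1).trans hy'
    calc t ^ (j + 1) * ‖fderiv ℝ h (t • y)‖ ≤ 1 * C :=
          mul_le_mul (pow_le_one₀ h0 h1) (hC _ hmem) (norm_nonneg _) zero_le_one
      _ = C := one_mul C
  · refine ae_of_all _ fun t _ y _ => ?_
    have h1 : HasFDerivAt h (fderiv ℝ h (t • y)) (t • y) :=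
      (hh.differentiable one_ne_zero _).hasFDerivAt
    have h2 : HasFDerivAt (fun y : V => t • y) (t • ContinuousLinearMap.id ℝ V) y :=
      (hasFDerivAt_id y).const_smul t
    refine ((h1.comp y h2).const_smul (t ^ j)).congr_fderiv ?_
    ext v
    simp [pow_succ, mul_smul]

theorem contDiff_radialIntegral [ProperSpace V] (k : ℕ) : ∀ {W : Type} [NormedAddCommGroup W] [NormedSpace ℝ W]
    (j : ℕ) {h : V → W}, ContDiff ℝ k h → ContDiff ℝ k (radialIntegral j h) := by
  -- The codomain `W` varies in the induction, since the derivative takes values in `V →L[ℝ] W`.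
  induction k with
  | zero =>
    intro W _ _ j h hh
    rw [Nat.cast_zero, contDiff_zero] at hh ⊢
    exact continuous_radialIntegral j hh
  | succ k ih =>
    intro W _ _ j h hh
    have h1 : ContDiff ℝ 1 h := hh.of_le (by exact_mod_cast Nat.le_add_left 1 k)
    have hd := hasFDerivAt_radialIntegral j h1
    have hcast : ((k + 1 : ℕ) : WithTop ℕ∞) = (k : WithTop ℕ∞) + 1 := by push_cast; rfl
    rw [hcast, contDiff_succ_iff_fderiv] at hh ⊢
    refine ⟨fun x => (hd x).differentiableAt, fun h => ?_, ?_⟩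
    · exact absurd h (by simp)
    · rw [funext fun x => (hd x).fderiv]
      exact ih (j + 1) hh.2.2

theorem apply_eq_radialIntegral_fderiv [CompleteSpace W] {f : V → W} (hf : ContDiff ℝ 1 f)
    (h0 : f 0 = 0) (x : V) : f x = radialIntegral 0 (fderiv ℝ f) x x := by
  have hc : Continuous (fderiv ℝ f) := hf.continuous_fderiv one_ne_zero
  have hd : ∀ t : ℝ, HasDerivAt (fun t : ℝ => f (t • x)) (fderiv ℝ f (t • x) x) t := fun t => by
    have h1 : HasFDerivAt f (fderiv ℝ f (t • x)) (t • x) :=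
      (hf.differentiable one_ne_zero _).hasFDerivAt
    have h2 : HasDerivAt (fun t : ℝ => t • x) x t := by
      simpa using (hasDerivAt_id t).smul_const x
    exact h1.comp_hasDerivAt t h2
  have hint : IntervalIntegrable (fun t : ℝ => fderiv ℝ f (t • x)) volume 0 1 :=
    (show Continuous fun t : ℝ => fderiv ℝ f (t • x) by fun_prop).intervalIntegrable _ _
  have h1 := intervalIntegral.integral_eq_sub_of_hasDerivAt (a := 0) (b := 1) (fun t _ => hd t)
    ((show Continuous fun t : ℝ => fderiv ℝ f (t • x) x by fun_prop).intervalIntegrable _ _)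
  rw [one_smul, zero_smul, h0, sub_zero] at h1
  rw [← h1]
  unfold radialIntegral
  simp only [pow_zero, one_smul]
  rw [ContinuousLinearMap.intervalIntegral_apply hint]

theorem radialIntegral_zero [CompleteSpace W] (j : ℕ) (h : V → W) :
    radialIntegral j h 0 = ((j + 1 : ℝ)⁻¹) • h 0 := by
  unfold radialIntegral
  simp only [smul_zero]
  rw [intervalIntegral.integral_smul_const, integral_pow]
  simp

/-- Second order Hadamard lemma. -/
theorem exists_contDiff_bilinear [ProperSpace V] [CompleteSpace W] (k : ℕ) {f : V → W}
    (hf : ContDiff ℝ ((k + 2 : ℕ) : WithTop ℕ∞) f) (h0 : f 0 = 0) (h1 : fderiv ℝ f 0 = 0) :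
    ∃ B : V → V →L[ℝ] V →L[ℝ] W, ContDiff ℝ k B ∧ (∀ x, f x = B x x x) ∧
      B 0 = (2 : ℝ)⁻¹ • fderiv ℝ (fderiv ℝ f) 0 := by
  have hcast : ((k + 2 : ℕ) : WithTop ℕ∞) = ((k + 1 : ℕ) : WithTop ℕ∞) + 1 := by push_cast; rfl
  have hcast' : ((k + 1 : ℕ) : WithTop ℕ∞) = (k : WithTop ℕ∞) + 1 := by push_cast; rfl
  have hf1 : ContDiff ℝ 1 f := hf.of_le (by exact_mod_cast Nat.le_add_left 1 (k + 1))
  have hDf : ContDiff ℝ ((k + 1 : ℕ) : WithTop ℕ∞) (fderiv ℝ f) := by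
    rw [hcast] at hf
    exact (contDiff_succ_iff_fderiv.1 hf).2.2
  have hDf1 : ContDiff ℝ 1 (fderiv ℝ f) :=
    hDf.of_le (by exact_mod_cast Nat.le_add_left 1 k)
  -- Hadamard's lemma is applied twice: `f x = G x x`, and since `G 0 = fderiv ℝ f 0 = 0`, also `G x
  -- = B x x`. The factor `1/2` in `B 0` is `∫ t dt`.
  set G := radialIntegral 0 (fderiv ℝ f) with hG
  have hGk : ContDiff ℝ ((k + 1 : ℕ) : WithTop ℕ∞) G := contDiff_radialIntegral _ 0 hDf
  have hG1 : ContDiff ℝ 1 G := hGk.of_le (by exact_mod_cast Nat.le_add_left 1 k)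
  have hG0 : G 0 = 0 := by rw [hG, radialIntegral_zero, h1, smul_zero]
  have hDG : fderiv ℝ G 0 = (2 : ℝ)⁻¹ • fderiv ℝ (fderiv ℝ f) 0 := by
    rw [(hasFDerivAt_radialIntegral 0 hDf1 0).fderiv, radialIntegral_zero]
    norm_num
  refine ⟨radialIntegral 0 (fderiv ℝ G), ?_, fun x => ?_, ?_⟩
  · rw [hcast'] at hGk
    exact contDiff_radialIntegral k 0 (contDiff_succ_iff_fderiv.1 hGk).2.2
  · rw [← apply_eq_radialIntegral_fderiv hG1 hG0, ← apply_eq_radialIntegral_fderiv hf1 h0]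
  · rw [radialIntegral_zero, hDG]
    norm_num

/-- Multiplication by a bump function globalises a germ, so that radial integrals, which see whole
segments, apply to it. -/
theorem exists_contDiff_eventuallyEq {V : Type} [NormedAddCommGroup V] [NormedSpace ℝ V]
    [HasContDiffBump V] {f : V → W} {x : V} {n : ℕ} (hf : ContDiffAt ℝ n f x) :
    ∃ g : V → W, ContDiff ℝ n g ∧ g =ᶠ[𝓝 x] f := by
  obtain ⟨r, hr, hball⟩ := Metric.eventually_nhds_iff_ball.1 (hf.eventually (by simp))
  let b : ContDiffBump x := ⟨r / 4, r / 2, by positivity, by linarith⟩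
  refine ⟨fun y => b y • f y, contDiff_iff_contDiffAt.2 fun y => ?_, ?_⟩
  · by_cases hy : y ∈ Metric.ball x r
    · exact (b.contDiff.contDiffAt (n := n)).smul (hball y hy)
    · have hev : (fun y => b y • f y) =ᶠ[𝓝 y] fun _ => 0 := by
        have hmem : (Metric.closedBall x (r / 2))ᶜ ∈ 𝓝 y := by
          refine Metric.isClosed_closedBall.isOpen_compl.mem_nhds fun h => hy ?_
          exact Metric.closedBall_subset_ball (by linarith) h
        filter_upwards [hmem] with z hz
        have : b z = 0 := b.zero_of_le_dist (by
          simp only [Set.mem_compl_iff, Metric.mem_closedBall, not_le] at hz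
          exact hz.le)
        rw [this, zero_smul]
      exact contDiffAt_const.congr_of_eventuallyEq hev
  · filter_upwards [b.eventuallyEq_one] with y hy
    simp [hy]

end Hadamard

/-! ### The Morse lemma -/

section Morse

theorem contDiff_flip {V : Type*} [NormedAddCommGroup V] [NormedSpace ℝ V] {n : WithTop ℕ∞} :
    ContDiff ℝ n fun b : V →L[ℝ] V →L[ℝ] ℝ => b.flip := by
  have h : IsBoundedLinearMap ℝ fun b : V →L[ℝ] V →L[ℝ] ℝ => b.flip :=
    { map_add := fun _ _ => rfl
      map_smul := fun _ _ => rfl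
      bound := ⟨1, one_pos, fun b => by simp⟩ }
  exact h.contDiff

/-- Locally near `J` with `J ^ 2 = 1`, self-adjoint elements have a smooth self-adjoint
square root with respect to `M ↦ M * J * M`. -/
theorem exists_contDiffAt_selfAdjoint_sqrt {𝔸 : Type*} [NormedRing 𝔸]
    [NormedAlgebra ℝ 𝔸] [CompleteSpace 𝔸] [StarRing 𝔸] [ContinuousStar 𝔸] (k : ℕ) (hk : k ≠ 0) {J : 𝔸}
    (hJ : J * J = 1) (hJs : IsSelfAdjoint J) :
    ∃ g : 𝔸 → 𝔸, ContDiffAt ℝ k g J ∧ g J = J ∧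
      (∀ᶠ S in 𝓝 J, g S * J * g S = S) ∧
      ∀ᶠ S in 𝓝 J, IsSelfAdjoint S → IsSelfAdjoint (g S) := by
  set Q : 𝔸 → 𝔸 := fun M => M * J * M with hQ
  have hQJ : Q J = J := by simp [hQ, hJ]
  have hQc : ContDiffAt ℝ k Q J := (contDiffAt_id.mul contDiffAt_const).mul contDiffAt_id
  set e : 𝔸 ≃L[ℝ] 𝔸 :=
    ContinuousLinearEquiv.smulLeft (Units.mk0 (2 : ℝ) two_ne_zero) with he
  -- The derivative sends `H` to `H J J + J J H = 2 H`, which is invertible.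
  have hQd : HasFDerivAt Q (e : 𝔸 →L[ℝ] 𝔸) J := by
    have h1 : HasFDerivAt (fun M : 𝔸 => M) (ContinuousLinearMap.id ℝ 𝔸) J :=
      hasFDerivAt_id J
    refine ((h1.mul' (hasFDerivAt_const J J)).mul' h1).congr_fderiv ?_
    ext1 H
    have : e H = (2 : ℝ) • H := rfl
    simp [this, two_smul, hJ, mul_assoc]
  have hk' : (k : WithTop ℕ∞) ≠ 0 := by exact_mod_cast hk
  have hs := hQc.hasStrictFDerivAt' hQd hk'
  set g := hQc.localInverse hQd hk' with hg
  have hleft : ∀ᶠ M in 𝓝 J, g (Q M) = M := hs.eventually_left_inverse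
  have hright : ∀ᶠ S in 𝓝 J, Q (g S) = S := by
    have := hs.eventually_right_inverse
    rw [hQJ] at this
    exact this
  have hgJ : g J = J := by
    have := hQc.localInverse_apply_image hQd hk'
    rwa [hQJ] at this
  have hgc : ContDiffAt ℝ k g J := by
    have := hQc.to_localInverse hQd hk'
    rwa [hQJ] at this
  refine ⟨g, hgc, hgJ, hright, ?_⟩
  have hstar : Tendsto (fun S => star (g S)) (𝓝 J) (𝓝 J) := by
    have h1 : ContinuousAt (fun S => star (g S)) J := hgc.continuousAt.star
    have h2 : star (g J) = J := by rw [hgJ]; exact hJs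
    rw [ContinuousAt, h2] at h1
    exact h1
  filter_upwards [hright, hstar.eventually hleft] with S h1 h2 hS
  -- `star (g S)` is near `J` and also solves `Q M = S`, so local uniqueness identifies it with `g
  -- S`.
  have h3 : Q (star (g S)) = S := by
    have : star (Q (g S)) = star S := by rw [h1]
    rw [hS.star_eq] at this
    refine Eq.trans ?_ this
    simp [hQ, hJs.star_eq, mul_assoc]
  rw [h3] at h2
  exact h2.symm

variable {V : Type} [NormedAddCommGroup V] [InnerProductSpace ℝ V] [FiniteDimensional ℝ V]

theorem exists_bilinear_toOperator : ∃ T : (V →L[ℝ] V →L[ℝ] ℝ) →L[ℝ] (V →L[ℝ] V),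
    ∀ b v w, inner ℝ (T b v) w = b v w :=
  ⟨ContinuousLinearMap.compL ℝ V (V →L[ℝ] ℝ) V
    { toFun := (InnerProductSpace.toDual ℝ V).symm
      map_add' := map_add _
      map_smul' := fun c b => by simp
      cont := (InnerProductSpace.toDual ℝ V).symm.continuous },
    fun _ _ _ => InnerProductSpace.toDual_symm_apply (𝕜 := ℝ)⟩

theorem exists_morse_coordinates (k : ℕ) (hk : k ≠ 0) {f : V → ℝ}
    (hf : ContDiff ℝ ((k + 2 : ℕ) : WithTop ℕ∞) f) (h0 : f 0 = 0) (h1 : fderiv ℝ f 0 = 0)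
    {J : V →L[ℝ] V} (hJ : J * J = 1)
    (hfJ : ∀ v w, fderiv ℝ (fderiv ℝ f) 0 v w = 2 * inner ℝ (J v) w) :
    ∃ Φ : V → V, ContDiffAt ℝ k Φ 0 ∧ Φ 0 = 0 ∧ HasFDerivAt Φ J 0 ∧
      ∀ᶠ x in 𝓝 0, f x = inner ℝ (J (Φ x)) (Φ x) := by
  have hk' : (k : WithTop ℕ∞) ≠ 0 := by exact_mod_cast hk
  obtain ⟨B, hBk, hfB, hB0⟩ := exists_contDiff_bilinear k hf h0 h1
  have hsymm : IsSymmSndFDerivAt ℝ f 0 := hf.contDiffAt.isSymmSndFDerivAt (by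
    rw [minSmoothness_of_isRCLikeNormedField]
    exact_mod_cast Nat.le_add_left 2 k)
  have hJs : IsSelfAdjoint J := by
    rw [ContinuousLinearMap.isSelfAdjoint_iff_isSymmetric]
    intro v w
    have h2 := hfJ v w
    have h3 := hfJ w v
    have h4 : fderiv ℝ (fderiv ℝ f) 0 v w = fderiv ℝ (fderiv ℝ f) 0 w v := hsymm v w
    change inner ℝ (J v) w = inner ℝ v (J w)
    rw [real_inner_comm (J w) v]
    linarith
  obtain ⟨T, hTinner⟩ := exists_bilinear_toOperator (V := V)
  -- `B x` need not be symmetric; symmetrising leaves the quadratic form unchanged and makes the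
  -- operator self-adjoint.
  set S : V → V →L[ℝ] V := fun x => (2 : ℝ)⁻¹ • T (B x + (B x).flip) with hS
  have hSinner : ∀ x v w, inner ℝ (S x v) w = (2 : ℝ)⁻¹ * (B x v w + B x w v) := fun x v w => by
    simp only [hS, _root_.smul_apply, real_inner_smul_left, hTinner]
    simp
  have hSs : ∀ x, IsSelfAdjoint (S x) := fun x => by
    rw [ContinuousLinearMap.isSelfAdjoint_iff_isSymmetric]
    intro v w
    change inner ℝ (S x v) w = inner ℝ v (S x w)
    rw [real_inner_comm (S x w) v, hSinner, hSinner, add_comm]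
  have hSk : ContDiff ℝ k S := by
    have hflip : ContDiff ℝ k fun x => (B x).flip := contDiff_flip.comp hBk
    have hT' : ContDiff ℝ k fun x => T (B x + (B x).flip) :=
      (hBk.add hflip).continuousLinearMap_comp T
    exact (contDiff_const (c := (2 : ℝ)⁻¹)).smul hT'
  have hS0 : S 0 = J := by
    ext1 v
    refine ext_inner_right ℝ fun w => ?_
    have h4 : fderiv ℝ (fderiv ℝ f) 0 w v = fderiv ℝ (fderiv ℝ f) 0 v w := hsymm w v
    rw [hSinner, hB0]
    simp only [_root_.smul_apply, smul_eq_mul, h4, hfJ]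
    ring
  have hfS : ∀ x, f x = inner ℝ (S x x) x := fun x => by rw [hSinner, hfB]; ring
  obtain ⟨g, hgk, hgJ, hgQ, hgs⟩ := exists_contDiffAt_selfAdjoint_sqrt k hk hJ hJs
  have hScont : Tendsto S (𝓝 0) (𝓝 J) := by
    have := hSk.continuous.tendsto 0
    rwa [hS0] at this
  have hMk : ContDiffAt ℝ k (fun x => g (S x)) 0 :=
    ContDiffAt.comp (g := g) 0 (hS0 ▸ hgk) hSk.contDiffAt
  refine ⟨fun x => g (S x) x, hMk.clm_apply contDiffAt_id, map_zero _, ?_, ?_⟩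
  · have h2 : HasFDerivAt (fun x => g (S x)) (fderiv ℝ (fun x => g (S x)) 0) 0 :=
      (hMk.differentiableAt hk').hasFDerivAt
    refine (h2.clm_apply (hasFDerivAt_id (0 : V))).congr_fderiv ?_
    simp only [hS0, hgJ, id, map_zero, add_zero]
    rfl
  · filter_upwards [hScont.eventually hgQ, hScont.eventually hgs] with x h2 h3
    -- With `M = g (S x)` self-adjoint, `⟨M J M x, x⟩ = ⟨J M x, M x⟩`.
    have h4 := (ContinuousLinearMap.isSelfAdjoint_iff_isSymmetric.1 (h3 (hSs x)))
      (J (g (S x) x)) x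
    rw [hfS]
    refine Eq.trans ?_ h4
    conv_lhs => rw [← h2]
    rfl

end Morse

/-! ### Non-degenerate critical points -/

theorem bilinear_eq_inner {D : ℕ} (B : PhaseSpace D →L[ℝ] PhaseSpace D →L[ℝ] ℝ)
    (x y : PhaseSpace D) :
    B x y = ∑ j, y j * ∑ i, B (EuclideanSpace.single i 1) (EuclideanSpace.single j 1) * x i := by
  have hsum : ∀ z : PhaseSpace D, z = ∑ i, z i • EuclideanSpace.single i (1 : ℝ) := fun z => by
    ext k
    simp [Finset.sum_apply, Pi.single_apply]
  conv_lhs => rw [hsum x, hsum y]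
  simp only [map_sum, map_smul, smul_eq_mul, _root_.sum_apply,
    _root_.smul_apply]
  simp [mul_comm]

theorem hessian_isHermitian {D : ℕ} {E : PhaseSpace D → ℝ} {p : PhaseSpace D}
    (hE : ContDiffAt ℝ 2 E p) : (hessian E p).IsHermitian := by
  have hsymm : IsSymmSndFDerivAt ℝ E p := hE.isSymmSndFDerivAt (by
    rw [minSmoothness_of_isRCLikeNormedField])
  ext i j
  simp only [hessian, Matrix.conjTranspose_apply, Matrix.of_apply, star_trivial]
  exact hsymm _ _

theorem hessian_apply_eigenvectorBasis {D : ℕ} {E : PhaseSpace D → ℝ} {p : PhaseSpace D}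
    (hE : ContDiffAt ℝ 2 E p) (hH : (hessian E p).IsHermitian) (j : Fin D) (y : PhaseSpace D) :
    fderiv ℝ (fderiv ℝ E) p (hH.eigenvectorBasis j) y =
      hH.eigenvalues j * inner ℝ (hH.eigenvectorBasis j) y := by
  have hsymm : IsSymmSndFDerivAt ℝ E p := hE.isSymmSndFDerivAt (by
    rw [minSmoothness_of_isRCLikeNormedField])
  have h1 := hH.mulVec_eigenvectorBasis j
  rw [bilinear_eq_inner, PiLp.inner_apply, Finset.mul_sum]
  refine Finset.sum_congr rfl fun k _ => ?_
  have h2 := congrFun h1 k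
  simp only [Matrix.mulVec, dotProduct, hessian, Matrix.of_apply, Pi.smul_apply, smul_eq_mul] at h2
  have h3 : ∀ i, fderiv ℝ (fderiv ℝ E) p (EuclideanSpace.single i 1) (EuclideanSpace.single k 1) =
      fderiv ℝ (fderiv ℝ E) p (EuclideanSpace.single k 1) (EuclideanSpace.single i 1) :=
    fun i => hsymm _ _
  simp only [h3, h2, hessian]
  simp
  ring

theorem sum_sign_eq_normalForm {D : ℕ} (σ : Fin D → SignType) (q : PhaseSpace D) :
    normalForm σ q = ∑ i, (σ i : ℝ) * q i * q i := by
  rw [normalForm_eq_quadForm]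
  exact Finset.sum_congr rfl fun i _ => by ring

/-- Reflection of the coordinates along a sign pattern. -/
noncomputable def signReflection {D : ℕ} (σ : Fin D → SignType) : PhaseSpace D →L[ℝ] PhaseSpace D :=
  LinearMap.toContinuousLinearMap
    { toFun := fun v => WithLp.toLp 2 fun i => (σ i : ℝ) * v i
      map_add' := fun v w => by ext i; simp [mul_add]
      map_smul' := fun c v => by ext i; simp; ring }

theorem signReflection_apply {D : ℕ} (σ : Fin D → SignType) (v : PhaseSpace D) (i : Fin D) :
    signReflection σ v i = (σ i : ℝ) * v i := rfl

theorem signReflection_mul_self {D : ℕ} {σ : Fin D → SignType} (hσ : ∀ i, σ i ≠ 0) :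
    signReflection σ * signReflection σ = 1 := by
  ext v i
  change signReflection σ (signReflection σ v) i = v i
  rw [signReflection_apply, signReflection_apply, ← mul_assoc]
  have := hσ i
  rcases h : σ i <;> simp_all

theorem inner_signReflection {D : ℕ} (σ : Fin D → SignType) (v w : PhaseSpace D) :
    inner ℝ (signReflection σ v) w = ∑ i, (σ i : ℝ) * v i * w i := by
  rw [PiLp.inner_apply]
  refine Finset.sum_congr rfl fun i _ => ?_
  rw [signReflection_apply]
  simp [mul_comm]

/-- Linear coordinates in which a diagonalised non-degenerate quadratic form is a sum of signed
squares. -/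
theorem exists_linear_normalization {D : ℕ} (b : OrthonormalBasis (Fin D) ℝ (PhaseSpace D))
    (B : PhaseSpace D →L[ℝ] PhaseSpace D →L[ℝ] ℝ) {ev : Fin D → ℝ} (hev : ∀ i, ev i ≠ 0)
    (hB : ∀ i y, B (b i) y = ev i * inner ℝ (b i) y) :
    ∃ W : PhaseSpace D ≃L[ℝ] PhaseSpace D, ∀ v w,
      B (W v) (W w) = 2 * inner ℝ (signReflection (fun i => SignType.sign (ev i)) v) w := by
  -- Scaling by `c i` turns the eigenvalue into `2 sign (ev i)`; the `2` matches the second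
  -- derivative of `⟨J v, v⟩`.
  set c : Fin D → ℝ := fun i => Real.sqrt (2 / |ev i|) with hc
  have hcpos : ∀ i, 0 < c i := fun i => Real.sqrt_pos.2 (div_pos two_pos (abs_pos.2 (hev i)))
  have hc2 : ∀ i, ev i * (c i * c i) = 2 * (SignType.sign (ev i) : ℝ) := fun i => by
    have h1 : c i * c i = 2 / |ev i| := Real.mul_self_sqrt (by positivity)
    have h2 : |ev i| ≠ 0 := abs_ne_zero.2 (hev i)
    rw [h1]
    field_simp
    rw [mul_comm, sign_mul_abs]
  set S : PhaseSpace D ≃ₗ[ℝ] PhaseSpace D :=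
    { toFun := fun v => WithLp.toLp 2 fun i => c i * v i
      map_add' := fun v w => by ext i; simp [mul_add]
      map_smul' := fun a v => by ext i; simp; ring
      invFun := fun v => WithLp.toLp 2 fun i => (c i)⁻¹ * v i
      left_inv := fun v => by ext i; simp [(hcpos i).ne']
      right_inv := fun v => by ext i; simp [(hcpos i).ne'] } with hS
  refine ⟨S.toContinuousLinearEquiv.trans b.repr.symm.toContinuousLinearEquiv, fun v w => ?_⟩
  have hW : ∀ v, (S.toContinuousLinearEquiv.trans b.repr.symm.toContinuousLinearEquiv) v =
      ∑ i, (c i * v i) • b i := fun v => by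
    change b.repr.symm (S v) = _
    rw [← b.sum_repr_symm]
    rfl
  have hinner : ∀ i, inner ℝ (b i) (∑ j, (c j * w j) • b j) = c i * w i := fun i => by
    rw [b.orthonormal.inner_right_fintype]
  rw [hW, hW, inner_signReflection, Finset.mul_sum, map_sum B, _root_.sum_apply]
  refine Finset.sum_congr rfl fun i _ => ?_
  rw [map_smul, _root_.smul_apply, hB, hinner, smul_eq_mul]
  calc c i * v i * (ev i * (c i * w i)) = ev i * (c i * c i) * v i * w i := by ring
    _ = _ := by rw [hc2]; ring

theorem fderiv_fderiv_comp_affine {V : Type*} [NormedAddCommGroup V] [NormedSpace ℝ V]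
    {E : V → ℝ} {p : V} (hE : ContDiffAt ℝ 2 E p) (W : V ≃L[ℝ] V) (v w : V) :
    fderiv ℝ (fun y => E (p + W y)) 0 v = fderiv ℝ E p (W v) ∧
    fderiv ℝ (fderiv ℝ fun y => E (p + W y)) 0 v w = fderiv ℝ (fderiv ℝ E) p (W v) (W w) := by
  have hA : ∀ y, HasFDerivAt (fun y => p + W y) (W : V →L[ℝ] V) y := fun y =>
    (W : V →L[ℝ] V).hasFDerivAt.const_add p
  have hA0 : p + W 0 = p := by simp
  have hcont : Tendsto (fun y => p + W y) (𝓝 0) (𝓝 p) := by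
    have := (hA 0).continuousAt
    rwa [ContinuousAt, hA0] at this
  have hd : ∀ᶠ x in 𝓝 p, DifferentiableAt ℝ E x :=
    (hE.eventually (by simp)).mono fun x hx => hx.differentiableAt two_ne_zero
  have hev : fderiv ℝ (fun y => E (p + W y)) =ᶠ[𝓝 0]
      fun y => (fderiv ℝ E (p + W y)).comp (W : V →L[ℝ] V) := by
    filter_upwards [hcont.eventually hd] with y hy
    exact (hy.hasFDerivAt.comp y (hA y)).fderiv
  refine ⟨by rw [hev.self_of_nhds]; simp, ?_⟩
  have hD2 : DifferentiableAt ℝ (fderiv ℝ E) (p + W 0) := by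
    rw [hA0]
    exact (hE.fderiv_right (m := 1) (by norm_num)).differentiableAt one_ne_zero
  have h1 : HasFDerivAt (fun y => fderiv ℝ E (p + W y))
      ((fderiv ℝ (fderiv ℝ E) (p + W 0)).comp (W : V →L[ℝ] V)) 0 :=
    hD2.hasFDerivAt.comp (0 : V) (hA 0)
  have h2 := h1.clm_comp (hasFDerivAt_const (W : V →L[ℝ] V) (0 : V))
  rw [hev.fderiv_eq, h2.fderiv, hA0]
  simp

theorem countP_charpoly_roots {D : ℕ} {A : Matrix (Fin D) (Fin D) ℝ} (hA : A.IsHermitian)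
    (P : ℝ → Prop) [DecidablePred P] :
    A.charpoly.roots.countP P = (Finset.univ.filter fun i => P (hA.eigenvalues i)).card := by
  rw [hA.roots_charpoly_eq_eigenvalues, Multiset.countP_map]
  rfl

/-- The Morse coordinates, precomposed with the affine map that diagonalises the Hessian at `p`,
have an invertible derivative there. The inverse function theorem gives the chart, and shrinking its
source secures the determinant bounds by continuity. -/
theorem exists_normalFormChart {D k : ℕ} (hk : 1 ≤ k) {E : PhaseSpace D → ℝ} {p : PhaseSpace D}
    (hp : E p = 0) (hE : ContDiffAt ℝ ((k + 2 : ℕ) : WithTop ℕ∞) E p) (hgrad : gradient E p = 0)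
    (hH : (hessian E p).IsHermitian) (hev : ∀ i, hH.eigenvalues i ≠ 0) :
    ∃ φ : OpenPartialHomeomorph (PhaseSpace D) (PhaseSpace D),
      IsNormalFormChart k E p (fun i => SignType.sign (hH.eigenvalues i)) φ ∧
      ∃ c C : ℝ, 0 < c ∧ ∀ x ∈ φ.source,
        c ≤ |(fderiv ℝ φ x).det| ∧ |(fderiv ℝ φ x).det| ≤ C := by
  have hk0 : k ≠ 0 := by omega
  have hk' : (k : WithTop ℕ∞) ≠ 0 := by exact_mod_cast hk0
  have hE2 : ContDiffAt ℝ 2 E p := hE.of_le (by exact_mod_cast Nat.le_add_left 2 k)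
  set σ : Fin D → SignType := fun i => SignType.sign (hH.eigenvalues i) with hσ
  have hσ0 : ∀ i, σ i ≠ 0 := fun i => by simpa [hσ] using hev i
  set J := signReflection σ with hJdef
  have hJ : J * J = 1 := signReflection_mul_self hσ0
  obtain ⟨W, hW⟩ := exists_linear_normalization hH.eigenvectorBasis (fderiv ℝ (fderiv ℝ E) p) hev
    (hessian_apply_eigenvectorBasis hE2 hH)
  have hDE : fderiv ℝ E p = 0 := by
    rw [← norm_eq_zero, ← norm_gradient, hgrad, norm_zero]
  have hcomp : ContDiffAt ℝ ((k + 2 : ℕ) : WithTop ℕ∞) (fun y => E (p + W y)) 0 := by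
    refine ContDiffAt.comp (g := E) (0 : PhaseSpace D) ?_ (contDiffAt_const.add W.contDiff.contDiffAt)
    simpa using hE
  obtain ⟨f, hf, hfE⟩ := exists_contDiff_eventuallyEq hcomp
  have hf0 : f 0 = 0 := by rw [hfE.self_of_nhds]; simpa using hp
  have hf1 : fderiv ℝ f 0 = 0 := by
    rw [hfE.fderiv_eq]
    ext v
    rw [(fderiv_fderiv_comp_affine hE2 W v v).1, hDE]
    rfl
  obtain ⟨Φ, hΦk, hΦ0, hΦJ, hΦf⟩ := exists_morse_coordinates k hk0 hf hf0 hf1 (J := J) hJ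
    fun v w => by rw [hfE.fderiv.fderiv_eq, (fderiv_fderiv_comp_affine hE2 W v w).2, hW]
  set G : PhaseSpace D → PhaseSpace D := fun x => W.symm (x - p) with hG
  have hG0 : G p = 0 := by simp [hG]
  have hGd : HasFDerivAt G (W.symm : PhaseSpace D →L[ℝ] PhaseSpace D) p :=
    (W.symm : PhaseSpace D →L[ℝ] PhaseSpace D).hasFDerivAt.comp p
      ((hasFDerivAt_id p).sub_const p)
  have hGc : Tendsto G (𝓝 p) (𝓝 0) := by
    have := hGd.continuousAt
    rwa [ContinuousAt, hG0] at this
  have hGk : ContDiffAt ℝ k G p :=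
    W.symm.contDiff.contDiffAt.comp p (contDiffAt_id.sub contDiffAt_const)
  set F : PhaseSpace D → PhaseSpace D := fun x => Φ (G x) with hF
  have hFk : ContDiffAt ℝ k F p := ContDiffAt.comp (g := Φ) p (hG0 ▸ hΦk) hGk
  -- The derivative at `p` is `J` after `W.symm`; `J` is its own inverse.
  set e : PhaseSpace D ≃L[ℝ] PhaseSpace D := W.symm.trans
    (ContinuousLinearEquiv.equivOfInverse J J (fun v => congrArg (fun T => T v) hJ)
      fun v => congrArg (fun T => T v) hJ) with he
  have hFd : HasFDerivAt F (e : PhaseSpace D →L[ℝ] PhaseSpace D) p := by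
    have h1 : HasFDerivAt Φ J (G p) := hG0 ▸ hΦJ
    exact h1.comp p hGd
  have hFE : ∀ᶠ x in 𝓝 p, E x = normalForm σ (F x) := by
    filter_upwards [hGc.eventually hΦf, hGc.eventually hfE] with x h1 h2
    rw [h2, inner_signReflection] at h1
    rw [sum_sign_eq_normalForm, ← h1]
    simp [hG]
  have hdet0 : (fderiv ℝ F p).det ≠ 0 := by
    rw [hFd.fderiv]
    exact (LinearEquiv.isUnit_det' e.toLinearEquiv).ne_zero
  set d := |(fderiv ℝ F p).det| with hd
  have hdpos : 0 < d := abs_pos.2 hdet0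
  have hF1 : ContDiffAt ℝ 1 F p := hFk.of_le (by exact_mod_cast hk)
  have hdetc : ContinuousAt (fun x => |(fderiv ℝ F x).det|) p :=
    ((ContinuousLinearMap.continuous_det.continuousAt).comp
      (hF1.fderiv_right (m := 0) (by norm_num)).continuousAt).abs
  have hdet : ∀ᶠ x in 𝓝 p, |(fderiv ℝ F x).det| ∈ Set.Icc (d / 2) (2 * d) :=
    hdetc.eventually (Icc_mem_nhds (by linarith) (by linarith))
  obtain ⟨U, hU, hUo, hpU⟩ := eventually_nhds_iff.1
    ((hFE.and hdet).and (hFk.eventually (by simp)))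
  set φ₀ := hFk.toOpenPartialHomeomorph F hFd hk' with hφ₀
  have hφ₀F : (φ₀ : PhaseSpace D → PhaseSpace D) = F := hFk.toOpenPartialHomeomorph_coe hFd hk'
  set φ := φ₀.restrOpen U hUo with hφ
  have hφF : (φ : PhaseSpace D → PhaseSpace D) = F := hφ₀F
  have hsrc : φ.source = φ₀.source ∩ U := φ₀.restrOpen_source U hUo
  have hsU : ∀ x ∈ φ.source, x ∈ U := fun x hx => (hsrc ▸ hx : x ∈ φ₀.source ∩ U).2
  refine ⟨φ, ⟨?_, ?_, ?_, ?_, ?_⟩, d / 2, 2 * d, by positivity, fun x hx => ?_⟩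
  · rw [hsrc]
    exact ⟨hFk.mem_toOpenPartialHomeomorph_source hFd hk', hpU⟩
  · rw [hφF, hF]
    simp only [hG0, hΦ0]
  · rw [hφF]
    exact fun x hx => (hU x (hsU x hx)).2.contDiffWithinAt
  · intro q hq
    have hx := φ.map_target hq
    obtain ⟨⟨-, h2⟩, h3⟩ := hU _ (hsU _ hx)
    -- The lower determinant bound gives smoothness of the inverse at every point of the target, not
    -- only at `0`.
    have hne : (fderiv ℝ F (φ.symm q)).det ≠ 0 := by
      rw [← abs_pos]
      exact (half_pos hdpos).trans_le h2.1
    refine (φ.contDiffAt_symm hq (f₀' :=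
      (fderiv ℝ F (φ.symm q)).toContinuousLinearEquivOfDetNeZero hne) ?_ ?_).contDiffWithinAt
    · rw [hφF]
      exact (h3.differentiableAt hk').hasFDerivAt
    · rwa [hφF]
  · intro q hq
    rw [(hU _ (hsU _ (φ.map_target hq))).1.1, ← hφF, φ.right_inv hq, hp, zero_add]
  · rw [hφF]
    exact (hU x (hsU x hx)).1.2

end VanHove

/-! ### The main theorem. -/

theorem mainTheorem3 (D : ℕ) (hD : 1 ≤ D) (E : VanHove.PhaseSpace D → ℝ)
    (p : VanHove.PhaseSpace D) (hp : E p = 0) :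
    (∀ k : ℕ, 1 ≤ k → ContDiffAt ℝ ((k + 2 : ℕ) : WithTop ℕ∞) E p → gradient E p = 0 →
      (VanHove.hessian E p).det ≠ 0 →
      ∀ m n : ℕ, m = VanHove.numNegEigenvalues (VanHove.hessian E p) →
        n = VanHove.numPosEigenvalues (VanHove.hessian E p) →
        m + n = D ∧
        (∃ (σ : Fin D → SignType)
            (φ : OpenPartialHomeomorph (VanHove.PhaseSpace D) (VanHove.PhaseSpace D)),
          VanHove.signCount σ (-1) = m ∧ VanHove.signCount σ 1 = n ∧
          VanHove.IsNormalFormChart k E p σ φ ∧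
          ∃ c C : ℝ, 0 < c ∧ ∀ x ∈ φ.source,
            c ≤ |(fderiv ℝ φ x).det| ∧ |(fderiv ℝ φ x).det| ≤ C) ∧
        VanHove.Dichotomy E p D m n) ∧
    (∀ (σ : Fin D → SignType)
        (φ : OpenPartialHomeomorph (VanHove.PhaseSpace D) (VanHove.PhaseSpace D)),
      VanHove.IsNormalFormChart 1 E p σ φ →
      ∀ D' δ : ℕ, δ = VanHove.signCount σ 0 → D' + δ = D →
        VanHove.Dichotomy E p D' (VanHove.signCount σ (-1)) (VanHove.signCount σ 1)) := by
  refine ⟨fun k hk hE hgrad hdet m n hm hn => ?_, fun σ φ hφ D' δ hδ hD' =>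
    hφ.dichotomy hD hp (hδ ▸ hD')⟩
  have hE2 : ContDiffAt ℝ 2 E p := hE.of_le (by exact_mod_cast Nat.le_add_left 2 k)
  have hH := VanHove.hessian_isHermitian hE2
  have hev : ∀ i, hH.eigenvalues i ≠ 0 := fun i hi => by
    rw [hH.det_eq_prod_eigenvalues] at hdet
    exact hdet (Finset.prod_eq_zero (Finset.mem_univ i) (by simp [hi]))
  obtain ⟨φ, hφ, hφdet⟩ := VanHove.exists_normalFormChart hk hp hE hgrad hH hev
  set σ : Fin D → SignType := fun i => SignType.sign (hH.eigenvalues i) with hσ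
  have hm' : VanHove.signCount σ (-1) = m := by
    rw [hm, VanHove.numNegEigenvalues, VanHove.countP_charpoly_roots hH, VanHove.signCount]
    simp only [hσ, sign_eq_neg_one_iff]
  have hn' : VanHove.signCount σ 1 = n := by
    rw [hn, VanHove.numPosEigenvalues, VanHove.countP_charpoly_roots hH, VanHove.signCount]
    simp only [hσ, sign_eq_one_iff]
  -- Invertibility of the Hessian leaves no zero eigenvalue, so the effective dimension is `D`.
  have h0 : VanHove.signCount σ 0 = 0 := by
    simp [VanHove.signCount, hσ, hev]
  refine ⟨?_, ⟨σ, φ, hm', hn', hφ, hφdet⟩, ?_⟩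
  · have h1 := VanHove.signCount_neg_add_signCount_pos σ
    have h2 := VanHove.card_ne_zero_add_signCount_zero σ
    omega
  · rw [← hm', ← hn']
    exact (hφ.of_le hk).dichotomy hD hp (by rw [h0, add_zero])
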